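/- Inner products are linear in the second variable. A continuous linear map $u:E\to B$ from a locally convex space to a Banach space is nuclear if $u(x)=\sum_n c_n f_n(x)y_n$ with $\sum_n|c_n|<\infty$, $(f_n)$ an equicontinuous sequence in $E'$ and $(y_n)$ bounded in $B$; $E$ is nuclear if all continuous linear maps from $E$ into Banach spaces are nuclear. A rigged Hilbert space $\Phi\subset\mathcal H\subset\Phi',\Phi^\times$ consists of a complex Hilbert space $\mathcal H$ and a dense linear subspace $\Phi$ with a complete nuclear locally convex topology for which the inclusion $\Phi\to\mathcal H$ is continuous; $\Phi'$ and $\Phi^\times$ are the spaces of continuous linear and of continuous antilinear functionals on $\Phi$. Let $\Phi\subset\mathcal H\subset\Phi',\Phi^\times$ be a rigged Hilbert space, and let $C:\mathcal H\to\mathcal H$ be a conjugation (an antilinear isometry with $C^2=1$) that maps $\Phi$ into $\Phi$ and is continuous there for the topology of $\Phi$. Let $\mathfrak L(\mathcal H)$ be the Hilbert space of Hilbert–Schmidt operators on $\mathcal H$ with $\langle A,B\rangle_{\mathrm{HS}}=\operatorname{Tr}(A^\dagger B)$. Let $\mathcal H\,\overline\otimes\,\mathcal H$ be the Hilbert tensor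 product and $\widehat\otimes$ the completion of the algebraic tensor product in the projective topology. Let $\tilde\Phi=C(\Phi)\subset\mathcal H$, with the topology carried over from $\Phi$ by $C$, and $\Phi_{\mathrm{TFD}}=\Phi\,\widehat\otimes\,\tilde\Phi$. Theorem. There is exactly one unitary $U:\mathcal H\,\overline\otimes\,\mathcal H\to\mathfrak L(\mathcal H)$ with $U(\varphi\otimes C\psi)=P_{\varphi,\psi}$ for all $\varphi,\psi\in\mathcal H$, where $P_{\varphi,\psi}(x)=\langle\psi,x\rangle\varphi$. Let $\Phi_{\mathfrak L}=U(\Phi\,\widehat\otimes\,\Phi)\subset\mathfrak L(\mathcal H)$ be the image of $\Phi\,\widehat\otimes\,\Phi$ under the composition of the canonical map $\Phi\,\widehat\otimes\,\Phi\to\mathcal H\,\overline\otimes\,\mathcal H$ with $U$, with the topology carried over from $\Phi\,\widehat\otimes\,\Phi$. Then: (1) $\Phi_{\mathfrak L}\subset\mathfrak L(\mathcal H)\subset\Phi_{\mathfrak L}',\Phi_{\mathfrak L}^\times$ and $\Phi_{\mathrm{TFD}}\subset\mathcal H\,\overline\otimes\,\mathcal H\subset\Phi_{\mathrm{TFD}}',\Phi_{\mathrm{TFD}}^\times$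 are rigged Hilbert spaces (in particular the canonical map $\Phi_{\mathrm{TFD}}\to\mathcal H\,\overline\otimes\,\mathcal H$ is injective). (2) There is a topological linear isomorphism $\Lambda$ from $\Phi_{\mathfrak L}$ onto $\Phi_{\mathrm{TFD}}$, given by $\Lambda X=U^{-1}X$ for $X\in\Phi_{\mathfrak L}$. (3) $\Lambda$ extends continuously to the dual and the anti-dual spaces: the map $\tilde\Lambda F=F\circ\Lambda^{-1}$ is a linear isomorphism from $\Phi_{\mathfrak L}'$ onto $\Phi_{\mathrm{TFD}}'$, and another one from $\Phi_{\mathfrak L}^\times$ onto $\Phi_{\mathrm{TFD}}^\times$. In both cases it is a homeomorphism for the strong topologies (uniform convergence on bounded sets) and for the weak-$*$ topologies. For every $A\in\mathfrak L(\mathcal H)$ it sends the functional $\langle A,\cdot\rangle_{\mathrm{HS}}$ on $\Phi_{\mathfrak L}$ (respectively $\langle\cdot,A\rangle_{\mathrm{HS}}$) to $\langle U^{-1}A,\cdot\rangle$ (respectively $\langle\cdot,U^{-1}A\rangle$) on $\Phi_{\mathrm{TFD}}$. It is the only weak-$*$ continuous map that sends, for every $X\in\Phi_{\mathfrak L}$,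 the functional defined by $X$ to the one defined by $\Lambda X$. -/

import Mathlib

open scoped TensorProduct InnerProductSpace

universe u v

set_option linter.unusedSectionVars false

noncomputable section

/-! ### Nuclear spaces and rigged Hilbert spaces -/

/-- A linear map `u` from a topological vector space `E` into a Banach space `B` is *nuclear* if
`u x = ∑ₙ cₙ fₙ(x) yₙ` with `(cₙ)` absolutely summable, `(fₙ)` an equicontinuous sequence of
continuous linear functionals on `E` and `(yₙ)` a bounded sequence in `B`. -/
def IsNuclearMap {E B : Type*} [AddCommGroup E] [Module ℂ E] [TopologicalSpace E]
    [NormedAddCommGroup B] [NormedSpace ℂ B] (u : E →L[ℂ] B) : Prop :=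
  ∃ (c : ℕ → ℂ) (f : ℕ → E →L[ℂ] ℂ) (y : ℕ → B),
    Summable (fun n => ‖c n‖) ∧
    (∃ p : Seminorm ℂ E, Continuous p ∧ ∀ n x, ‖f n x‖ ≤ p x) ∧
    (∃ M : ℝ, ∀ n, ‖y n‖ ≤ M) ∧
    ∀ x, HasSum (fun n => (c n * f n x) • y n) (u x)

/-- A locally convex space is *nuclear* if each continuous linear map from it into a Banach space
is nuclear (for a locally convex space this is equivalent to the definition by canonical maps
between its local Banach spaces; those live in the universe of the space itself). -/
def IsNuclear (E : Type u) [AddCommGroup E] [Module ℂ E] [TopologicalSpace E] : Prop :=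
  ∀ (B : Type u) [NormedAddCommGroup B] [NormedSpace ℂ B] [CompleteSpace B] (u : E →L[ℂ] B),
    IsNuclearMap u

/-- The triplet `Φ ⊂ H ⊂ Φ', Φ^×` is a *rigged Hilbert space*: `Φ` with its own topology is a
complete nuclear locally convex space, and the inclusion `ι : Φ → H` is linear, injective and
continuous with dense range. The duals `Φ'`, `Φ^×` are the spaces `Φ →L[ℂ] ℂ` and `Φ →L⋆[ℂ] ℂ`
of continuous linear and continuous antilinear functionals. -/
structure IsRiggedHilbertSpace {Φ : Type u} {H : Type v} [AddCommGroup Φ] [Module ℂ Φ]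
    [TopologicalSpace Φ] [NormedAddCommGroup H] [InnerProductSpace ℂ H]
    (ι : Φ →L[ℂ] H) : Prop where
  isTopologicalAddGroup : IsTopologicalAddGroup Φ
  continuousSMul : ContinuousSMul ℂ Φ
  locallyConvex : PolynormableSpace ℂ Φ
  complete : @CompleteSpace Φ (IsTopologicalAddGroup.rightUniformSpace Φ)
  nuclear : IsNuclear Φ
  injective : Function.Injective ι
  denseRange : DenseRange ι

/-! ### Images of topological vector spaces -/

section Image

variable {σ : ℂ →+* ℂ} [RingHomSurjective σ] {E G : Type*}
  [AddCommGroup E] [Module ℂ E] [TopologicalSpace E]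
  [AddCommGroup G] [Module ℂ G] [TopologicalSpace G]

/-- The image `f(E) ⊂ G` of a continuous (semi)linear map, with the topology carried over from `E`
(and not the one induced by `G`). -/
def ImageSpace (f : E →SL[σ] G) : Type _ := LinearMap.range (f : E →ₛₗ[σ] G)

instance (f : E →SL[σ] G) : AddCommGroup (ImageSpace f) :=
  inferInstanceAs (AddCommGroup (LinearMap.range (f : E →ₛₗ[σ] G)))

instance (f : E →SL[σ] G) : Module ℂ (ImageSpace f) :=
  inferInstanceAs (Module ℂ (LinearMap.range (f : E →ₛₗ[σ] G)))

instance (f : E →SL[σ] G) : TopologicalSpace (ImageSpace f) :=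
  TopologicalSpace.coinduced (fun x : E => (⟨f x, ⟨x, rfl⟩⟩ : ImageSpace f)) inferInstance

/-- The inclusion of the image `f(E)` in `G`. -/
def ImageSpace.incl (f : E →SL[σ] G) : ImageSpace f →L[ℂ] G where
  toLinearMap := (LinearMap.range (f : E →ₛₗ[σ] G)).subtype
  cont := continuous_coinduced_dom.2 f.continuous

end Image

/-! ### Tensor products -/

section Tensor

variable (E F : Type*) [AddCommGroup E] [Module ℂ E] [TopologicalSpace E]
  [AddCommGroup F] [Module ℂ F] [TopologicalSpace F]

/-- The algebraic tensor product `E ⊗ F`, to be equipped with the projective topology. -/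
def ProjTensor : Type _ := E ⊗[ℂ] F

instance : AddCommGroup (ProjTensor E F) := inferInstanceAs (AddCommGroup (E ⊗[ℂ] F))

instance : Module ℂ (ProjTensor E F) := inferInstanceAs (Module ℂ (E ⊗[ℂ] F))

/-- The elementary tensor `x ⊗ y`. -/
def ProjTensor.mk {E F : Type*} [AddCommGroup E] [Module ℂ E] [AddCommGroup F] [Module ℂ F]
    (x : E) (y : F) : ProjTensor E F := x ⊗ₜ[ℂ] y

/-- All seminorms `r` on `E ⊗ F` such that `(x, y) ↦ r (x ⊗ y)` is continuous. -/
def projSeminorms : SeminormFamily ℂ (ProjTensor E F)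
    {r : Seminorm ℂ (ProjTensor E F) // Continuous fun z : E × F => r (ProjTensor.mk z.1 z.2)} :=
  fun r => r.1

instance : Nonempty {r : Seminorm ℂ (ProjTensor E F) //
    Continuous fun z : E × F => r (ProjTensor.mk z.1 z.2)} :=
  ⟨⟨0, by simpa using continuous_const⟩⟩

/-- The projective topology: the finest locally convex topology on `E ⊗ F` for which
`(x, y) ↦ x ⊗ y` is continuous. -/
instance : TopologicalSpace (ProjTensor E F) := (projSeminorms E F).moduleFilterBasis.topology

theorem withSeminorms_projSeminorms : WithSeminorms (projSeminorms E F) := ⟨rfl⟩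

instance : IsTopologicalAddGroup (ProjTensor E F) :=
  (withSeminorms_projSeminorms E F).topologicalAddGroup

instance : ContinuousSMul ℂ (ProjTensor E F) :=
  (withSeminorms_projSeminorms E F).continuousSMul

instance : UniformSpace (ProjTensor E F) := IsTopologicalAddGroup.rightUniformSpace _

instance : IsUniformAddGroup (ProjTensor E F) := isUniformAddGroup_of_addCommGroup

instance : UniformContinuousConstSMul ℂ (ProjTensor E F) :=
  uniformContinuousConstSMul_of_continuousConstSMul _ _

/-- The completed (projective) tensor product `E ⊗̂ F`. -/
abbrev CompletedTensor : Type _ := UniformSpace.Completion (ProjTensor E F)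

end Tensor

/-- The Hilbert tensor product: the completion of `H ⊗ K` for the inner product with
`⟨x ⊗ y, x' ⊗ y'⟩ = ⟨x, x'⟩ ⟨y, y'⟩`. -/
abbrev HilbertTensor (H K : Type*) [NormedAddCommGroup H] [InnerProductSpace ℂ H]
    [NormedAddCommGroup K] [InnerProductSpace ℂ K] : Type _ :=
  UniformSpace.Completion (H ⊗[ℂ] K)

/-- The elementary tensor `x ⊗ y` in the Hilbert tensor product. -/
def HilbertTensor.mk {H K : Type*} [NormedAddCommGroup H] [InnerProductSpace ℂ H]
    [NormedAddCommGroup K] [InnerProductSpace ℂ K] (x : H) (y : K) : HilbertTensor H K :=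
  ((x ⊗ₜ[ℂ] y : H ⊗[ℂ] K) : UniformSpace.Completion (H ⊗[ℂ] K))

section TensorInclusion

variable {Φ Ψ H K : Type*} [AddCommGroup Φ] [Module ℂ Φ] [TopologicalSpace Φ]
  [AddCommGroup Ψ] [Module ℂ Ψ] [TopologicalSpace Ψ]
  [NormedAddCommGroup H] [InnerProductSpace ℂ H] [NormedAddCommGroup K] [InnerProductSpace ℂ K]

/-- The map `ι ⊗ κ : Φ ⊗ Ψ → H ⊗ K` of algebraic tensor products; it is continuous from the
projective topology to the topology of the inner product. -/
def algTensorIncl (ι : Φ →L[ℂ] H) (κ : Ψ →L[ℂ] K) : ProjTensor Φ Ψ →L[ℂ] H ⊗[ℂ] K where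
  toLinearMap := (TensorProduct.map (ι : Φ →ₗ[ℂ] H) (κ : Ψ →ₗ[ℂ] K) : Φ ⊗[ℂ] Ψ →ₗ[ℂ] H ⊗[ℂ] K)
  cont := by
    let T : ProjTensor Φ Ψ →ₗ[ℂ] H ⊗[ℂ] K :=
      (TensorProduct.map (ι : Φ →ₗ[ℂ] H) (κ : Ψ →ₗ[ℂ] K) : Φ ⊗[ℂ] Ψ →ₗ[ℂ] H ⊗[ℂ] K)
    have hT : Continuous fun z : Φ × Ψ =>
        ((normSeminorm ℂ (H ⊗[ℂ] K)).comp T) (ProjTensor.mk z.1 z.2) := by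
      have h : ∀ z : Φ × Ψ, ((normSeminorm ℂ (H ⊗[ℂ] K)).comp T) (ProjTensor.mk z.1 z.2)
          = ‖ι z.1‖ * ‖κ z.2‖ := fun z => TensorProduct.norm_tmul (𝕜 := ℂ) (ι z.1) (κ z.2)
      simp only [h]
      fun_prop
    exact (withSeminorms_projSeminorms Φ Ψ).continuous_normedSpace_rng (H ⊗[ℂ] K) T
      ⟨{⟨_, hT⟩}, 1, by simp [projSeminorms]⟩

/-- The canonical map `Φ ⊗̂ Ψ → H ⊗̄ K` determined by `φ ⊗ ψ ↦ ι φ ⊗ κ ψ`. -/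
def tensorIncl (ι : Φ →L[ℂ] H) (κ : Ψ →L[ℂ] K) : CompletedTensor Φ Ψ →L[ℂ] HilbertTensor H K :=
  (algTensorIncl ι κ).completion

end TensorInclusion

/-! ### The Liouville space of Hilbert–Schmidt operators -/

section Liouville

variable (H : Type*) [NormedAddCommGroup H] [InnerProductSpace ℂ H] [CompleteSpace H]

/-- A choice of index set for an orthonormal (Hilbert) basis of `H`. -/
def hsIndex : Set H := (exists_hilbertBasis ℂ H).choose

/-- An orthonormal (Hilbert) basis of `H`; nothing below depends on the choice, see
`LiouvilleSpace.mem_iff` and `LiouvilleSpace.hasSum_inner`. -/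
def hsBasis : HilbertBasis (hsIndex H) ℂ H := (exists_hilbertBasis ℂ H).choose_spec.choose

variable {H}

theorem enorm_sq_eq_tsum {I : Type*} (b : HilbertBasis I ℂ H) (x : H) :
    ‖x‖ₑ ^ 2 = ∑' i, ‖⟪b i, x⟫_ℂ‖ₑ ^ 2 := by
  have h := b.hasSum_inner_mul_inner x x
  have h2 : HasSum (fun i => ‖⟪b i, x⟫_ℂ‖ ^ 2) (‖x‖ ^ 2) := by
    have h3 := Complex.hasSum_re h
    have e : (⟪x, x⟫_ℂ).re = ‖x‖ ^ 2 := inner_self_eq_norm_sq (𝕜 := ℂ) x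
    rw [e] at h3
    refine h3.congr_fun ?_
    intro i
    rw [← inner_conj_symm x (b i), ← Complex.normSq_eq_conj_mul_self, Complex.ofReal_re,
      Complex.normSq_eq_norm_sq]
  have h4 := ENNReal.ofReal_tsum_of_nonneg (fun i => sq_nonneg ‖⟪b i, x⟫_ℂ‖) h2.summable
  rw [h2.tsum_eq] at h4
  simpa [ENNReal.ofReal_pow] using h4

theorem tsum_enorm_sq_eq_adjoint {I J : Type*} (b : HilbertBasis I ℂ H) (c : HilbertBasis J ℂ H)
    (A : H →L[ℂ] H) :
    ∑' i, ‖A (b i)‖ₑ ^ 2 = ∑' j, ‖ContinuousLinearMap.adjoint A (c j)‖ₑ ^ 2 := by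
  calc ∑' i, ‖A (b i)‖ₑ ^ 2 = ∑' i, ∑' j, ‖⟪c j, A (b i)⟫_ℂ‖ₑ ^ 2 :=
        tsum_congr fun i => enorm_sq_eq_tsum c _
    _ = ∑' j, ∑' i, ‖⟪c j, A (b i)⟫_ℂ‖ₑ ^ 2 := ENNReal.tsum_comm
    _ = ∑' j, ∑' i, ‖⟪b i, ContinuousLinearMap.adjoint A (c j)⟫_ℂ‖ₑ ^ 2 := by
        refine tsum_congr fun j => tsum_congr fun i => ?_
        rw [ContinuousLinearMap.adjoint_inner_right, ← inner_conj_symm, ← ofReal_norm,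
          ← ofReal_norm, RCLike.norm_conj]
    _ = ∑' j, ‖ContinuousLinearMap.adjoint A (c j)‖ₑ ^ 2 :=
        tsum_congr fun j => (enorm_sq_eq_tsum b _).symm

theorem tsum_enorm_sq_eq {I J : Type*} (b : HilbertBasis I ℂ H) (c : HilbertBasis J ℂ H)
    (A : H →L[ℂ] H) : ∑' i, ‖A (b i)‖ₑ ^ 2 = ∑' j, ‖A (c j)‖ₑ ^ 2 :=
  (tsum_enorm_sq_eq_adjoint b c A).trans (tsum_enorm_sq_eq_adjoint c c A).symm

theorem ofReal_tsum_norm_sq {I : Type*} (b : I → H) (A : H →L[ℂ] H)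
    (h : Summable fun i => ‖A (b i)‖ ^ 2) :
    ENNReal.ofReal (∑' i, ‖A (b i)‖ ^ 2) = ∑' i, ‖A (b i)‖ₑ ^ 2 := by
  rw [ENNReal.ofReal_tsum_of_nonneg (fun i => sq_nonneg _) h]
  simp [ENNReal.ofReal_pow]

theorem summable_norm_sq_iff {I : Type*} (b : HilbertBasis I ℂ H) (A : H →L[ℂ] H) :
    Summable (fun i => ‖A (b i)‖ ^ 2) ↔ ∑' i, ‖A (b i)‖ₑ ^ 2 ≠ ⊤ := by
  have h : ∀ i, ‖A (b i)‖ₑ ^ 2 = ((‖A (b i)‖₊ ^ 2 : NNReal) : ENNReal) := fun i => by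
    rw [ENNReal.coe_pow]; rfl
  simp only [h, ENNReal.tsum_coe_ne_top_iff_summable, ← NNReal.summable_coe]
  simp

theorem summable_hs_add {I : Type*} (b : I → H) {A B : H →L[ℂ] H}
    (hA : Summable fun i => ‖A (b i)‖ ^ 2) (hB : Summable fun i => ‖B (b i)‖ ^ 2) :
    Summable fun i => ‖(A + B) (b i)‖ ^ 2 := by
  refine Summable.of_nonneg_of_le (fun i => sq_nonneg _) (fun i => ?_)
    ((hA.mul_left 2).add (hB.mul_left 2))
  have h := norm_add_le (A (b i)) (B (b i))
  have h0 := norm_nonneg (A (b i) + B (b i))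
  rw [add_apply]
  nlinarith [sq_nonneg (‖A (b i)‖ - ‖B (b i)‖)]

variable (H) in
/-- The subspace of Hilbert–Schmidt operators: `∑ᵢ ‖A eᵢ‖² < ∞` for an orthonormal basis. -/
def hsSubmodule : Submodule ℂ (H →L[ℂ] H) where
  carrier := {A | Summable fun i => ‖A (hsBasis H i)‖ ^ 2}
  zero_mem' := by simp
  add_mem' := fun hA hB => summable_hs_add _ hA hB
  smul_mem' := fun a A hA => by
    have := Summable.mul_left (‖a‖ ^ 2) hA
    simpa [norm_smul, mul_pow] using this

variable (H) in
/-- The Liouville space `𝔏(H)` of Hilbert–Schmidt operators on `H`. It carries the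
Hilbert–Schmidt inner product, not the operator norm. -/
def LiouvilleSpace : Type _ := hsSubmodule H

instance : AddCommGroup (LiouvilleSpace H) := inferInstanceAs (AddCommGroup (hsSubmodule H))

instance : Module ℂ (LiouvilleSpace H) := inferInstanceAs (Module ℂ (hsSubmodule H))

/-- An element of the Liouville space as a bounded operator on `H`. -/
def LiouvilleSpace.toOp : LiouvilleSpace H →ₗ[ℂ] (H →L[ℂ] H) := (hsSubmodule H).subtype

theorem LiouvilleSpace.toOp_injective :
    Function.Injective (LiouvilleSpace.toOp : LiouvilleSpace H → (H →L[ℂ] H)) :=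
  Subtype.val_injective

theorem summable_hs_inner {I : Type*} (b : I → H) {A B : H →L[ℂ] H}
    (hA : Summable fun i => ‖A (b i)‖ ^ 2) (hB : Summable fun i => ‖B (b i)‖ ^ 2) :
    Summable fun i => ⟪A (b i), B (b i)⟫_ℂ := by
  refine Summable.of_norm_bounded (hA.add hB) fun i => ?_
  have h := norm_inner_le_norm (𝕜 := ℂ) (A (b i)) (B (b i))
  nlinarith [sq_nonneg (‖A (b i)‖ - ‖B (b i)‖), sq_nonneg (‖A (b i)‖), sq_nonneg (‖B (b i)‖)]

/-- The Hilbert–Schmidt inner product `⟨A, B⟩ = Tr(A† B) = ∑ᵢ ⟨A eᵢ, B eᵢ⟩`. -/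
instance : InnerProductSpace.Core ℂ (LiouvilleSpace H) where
  inner A B := ∑' i, ⟪A.toOp (hsBasis H i), B.toOp (hsBasis H i)⟫_ℂ
  conj_inner_symm A B := by
    rw [Complex.conj_tsum]
    exact tsum_congr fun i => inner_conj_symm _ _
  re_inner_nonneg A := by
    have h : ∀ i, ⟪A.toOp (hsBasis H i), A.toOp (hsBasis H i)⟫_ℂ
        = ((‖A.toOp (hsBasis H i)‖ ^ 2 : ℝ) : ℂ) := fun i => by
      rw [inner_self_eq_norm_sq_to_K]; simp
    simp only [h, ← Complex.ofReal_tsum]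
    exact tsum_nonneg fun i => sq_nonneg _
  add_left A B D := by
    simp only [map_add, add_apply, inner_add_left]
    exact (summable_hs_inner _ A.2 D.2).tsum_add (summable_hs_inner _ B.2 D.2)
  smul_left A B a := by
    simp only [map_smul, smul_apply, inner_smul_left]
    exact tsum_mul_left
  definite A hA := by
    have h : ∀ i, ⟪A.toOp (hsBasis H i), A.toOp (hsBasis H i)⟫_ℂ
        = ((‖A.toOp (hsBasis H i)‖ ^ 2 : ℝ) : ℂ) := fun i => by
      rw [inner_self_eq_norm_sq_to_K]; simp
    have h1 : ∑' i, ‖A.toOp (hsBasis H i)‖ ^ 2 = 0 := by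
      have h2 : ∑' i, ⟪A.toOp (hsBasis H i), A.toOp (hsBasis H i)⟫_ℂ = 0 := hA
      simp only [h, ← Complex.ofReal_tsum] at h2
      exact_mod_cast h2
    have h3 : HasSum (fun i => ‖A.toOp (hsBasis H i)‖ ^ 2) 0 := h1 ▸ A.2.hasSum
    have h4 := (hasSum_zero_iff_of_nonneg fun i => sq_nonneg _).1 h3
    apply LiouvilleSpace.toOp_injective
    rw [map_zero]
    refine ContinuousLinearMap.ext_on (Submodule.dense_iff_topologicalClosure_eq_top.2
      (hsBasis H).dense_span) ?_
    rintro _ ⟨i, rfl⟩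
    simpa using congrFun h4 i

instance : NormedAddCommGroup (LiouvilleSpace H) :=
  InnerProductSpace.Core.toNormedAddCommGroup (𝕜 := ℂ)

instance : InnerProductSpace ℂ (LiouvilleSpace H) := InnerProductSpace.ofCore _

theorem LiouvilleSpace.inner_def (A B : LiouvilleSpace H) :
    ⟪A, B⟫_ℂ = ∑' i, ⟪A.toOp (hsBasis H i), B.toOp (hsBasis H i)⟫_ℂ := rfl

/-- Membership in `𝔏(H)` can be tested on any orthonormal basis. -/
theorem LiouvilleSpace.mem_iff {I : Type*} (b : HilbertBasis I ℂ H) (A : H →L[ℂ] H) :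
    A ∈ hsSubmodule H ↔ Summable fun i => ‖A (b i)‖ ^ 2 := by
  change Summable (fun i => ‖A (hsBasis H i)‖ ^ 2) ↔ _
  rw [summable_norm_sq_iff, summable_norm_sq_iff, tsum_enorm_sq_eq (hsBasis H) b]

/-- The Hilbert–Schmidt norm can be computed in any orthonormal basis. -/
theorem LiouvilleSpace.hasSum_norm_sq {I : Type*} (b : HilbertBasis I ℂ H)
    (A : LiouvilleSpace H) : HasSum (fun i => ‖A.toOp (b i)‖ ^ 2) (‖A‖ ^ 2) := by
  have hb := (LiouvilleSpace.mem_iff b A.toOp).1 A.2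
  have e : ‖A‖ ^ 2 = ∑' i, ‖A.toOp (hsBasis H i)‖ ^ 2 := by
    have h : (⟪A, A⟫_ℂ) = ((‖A‖ ^ 2 : ℝ) : ℂ) := by
      rw [inner_self_eq_norm_sq_to_K]; simp
    rw [LiouvilleSpace.inner_def] at h
    have h' : ∀ i, ⟪A.toOp (hsBasis H i), A.toOp (hsBasis H i)⟫_ℂ
        = ((‖A.toOp (hsBasis H i)‖ ^ 2 : ℝ) : ℂ) := fun i => by
      rw [inner_self_eq_norm_sq_to_K]; simp
    simp only [h', ← Complex.ofReal_tsum] at h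
    exact_mod_cast h.symm
  have e2 : ∑' i, ‖A.toOp (hsBasis H i)‖ ^ 2 = ∑' i, ‖A.toOp (b i)‖ ^ 2 := by
    rw [← ENNReal.ofReal_eq_ofReal_iff (tsum_nonneg fun i => sq_nonneg _)
      (tsum_nonneg fun i => sq_nonneg _), ofReal_tsum_norm_sq _ A.toOp A.2,
      ofReal_tsum_norm_sq _ A.toOp hb, tsum_enorm_sq_eq (hsBasis H) b]
  rw [e, e2]
  exact hb.hasSum

/-- The Hilbert–Schmidt inner product can be computed in any orthonormal basis. -/
theorem LiouvilleSpace.hasSum_inner {I : Type*} (b : HilbertBasis I ℂ H)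
    (A B : LiouvilleSpace H) :
    HasSum (fun i => ⟪A.toOp (b i), B.toOp (b i)⟫_ℂ) ⟪A, B⟫_ℂ := by
  have h : ∀ D : LiouvilleSpace H, HasSum (fun i => ((‖D.toOp (b i)‖ : ℂ)) ^ 2) ((‖D‖ : ℂ) ^ 2) :=
    fun D => by exact_mod_cast LiouvilleSpace.hasSum_norm_sq b D
  have h1 := ((((h (A + B)).sub (h (A - B))).add
    (((h (A - Complex.I • B)).sub (h (A + Complex.I • B))).mul_right Complex.I))).div_const 4
  rw [inner_eq_sum_norm_sq_div_four]
  refine h1.congr_fun ?_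
  intro i
  rw [inner_eq_sum_norm_sq_div_four]
  simp

end Liouville

/-! ### Functionals and weak-* continuity -/

/-- For `ι : Φ → H` and `v ∈ H` the bra `x ↦ ⟨v, ι x⟩`, an element of the dual `Φ'`. -/
def braFunctional {Φ H : Type*} [AddCommGroup Φ] [Module ℂ Φ] [TopologicalSpace Φ]
    [NormedAddCommGroup H] [InnerProductSpace ℂ H] (ι : Φ →L[ℂ] H) (v : H) : Φ →L[ℂ] ℂ :=
  (innerSL ℂ v).comp ι

/-- For `ι : Φ → H` and `v ∈ H` the ket `x ↦ ⟨ι x, v⟩`, an element of the anti-dual `Φ^×`. -/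
def ketFunctional {Φ H : Type*} [AddCommGroup Φ] [Module ℂ Φ] [TopologicalSpace Φ]
    [NormedAddCommGroup H] [InnerProductSpace ℂ H] (ι : Φ →L[ℂ] H) (v : H) : Φ →L⋆[ℂ] ℂ :=
  ((innerSL ℂ).flip v).comp ι

/-- Continuity of a map between spaces of continuous (anti)linear functionals, both with the
weak-* topology (pointwise convergence). -/
def WeakStarContinuous {σ : ℂ →+* ℂ} {E F : Type*} [AddCommGroup E] [Module ℂ E]
    [TopologicalSpace E] [AddCommGroup F] [Module ℂ F] [TopologicalSpace F]
    (G : (E →SL[σ] ℂ) → (F →SL[σ] ℂ)) : Prop :=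
  @Continuous _ _
    (TopologicalSpace.induced (fun (f : E →SL[σ] ℂ) (x : E) => f x) inferInstance)
    (TopologicalSpace.induced (fun (f : F →SL[σ] ℂ) (y : F) => f y) inferInstance) G

/-! ### Thermo Field Dynamics and the rigged Liouville space -/

section Rigged

variable {Φ H : Type*} [AddCommGroup Φ] [Module ℂ Φ] [TopologicalSpace Φ]
  [NormedAddCommGroup H] [InnerProductSpace ℂ H]

/-- The tilde space `Φ̃ = C(Φ) ⊂ H` for a tilde operator `C`, with the topology carried over
from `Φ`. -/
abbrev TildeSpace (C : H →ₗᵢ⋆[ℂ] H) (ι : Φ →L[ℂ] H) : Type _ :=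
  ImageSpace (C.toContinuousLinearMap.comp ι)

/-- The inclusion of the tilde space `Φ̃` in `H`. -/
abbrev tildeIncl (C : H →ₗᵢ⋆[ℂ] H) (ι : Φ →L[ℂ] H) : TildeSpace C ι →L[ℂ] H :=
  ImageSpace.incl (C.toContinuousLinearMap.comp ι)

/-- The test space `Φ_TFD = Φ ⊗̂ Φ̃`. -/
abbrev TFDSpace (C : H →ₗᵢ⋆[ℂ] H) (ι : Φ →L[ℂ] H) : Type _ :=
  CompletedTensor Φ (TildeSpace C ι)

/-- The canonical map `Φ_TFD → H ⊗̄ H`. -/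
abbrev tfdIncl (C : H →ₗᵢ⋆[ℂ] H) (ι : Φ →L[ℂ] H) : TFDSpace C ι →L[ℂ] HilbertTensor H H :=
  tensorIncl ι (tildeIncl C ι)

variable [CompleteSpace H]

/-- The space `Φ_𝔏 = U(Φ ⊗̂ Φ) ⊂ 𝔏(H)`, with the topology carried over from `Φ ⊗̂ Φ`. -/
abbrev RiggedLiouville (U : HilbertTensor H H ≃ₗᵢ[ℂ] LiouvilleSpace H) (ι : Φ →L[ℂ] H) : Type _ :=
  ImageSpace ((U.toContinuousLinearEquiv : HilbertTensor H H →L[ℂ] LiouvilleSpace H).comp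
    (tensorIncl ι ι))

/-- The inclusion of `Φ_𝔏` in `𝔏(H)`. -/
abbrev liouvilleIncl (U : HilbertTensor H H ≃ₗᵢ[ℂ] LiouvilleSpace H) (ι : Φ →L[ℂ] H) :
    RiggedLiouville U ι →L[ℂ] LiouvilleSpace H :=
  ImageSpace.incl ((U.toContinuousLinearEquiv : HilbertTensor H H →L[ℂ] LiouvilleSpace H).comp
    (tensorIncl ι ι))

end Rigged

end

open Topology Filter UniformSpace

noncomputable section

/-! ### Continuous seminorms -/

section Seminorms

variable {E : Type*} [AddCommGroup E] [Module ℂ E]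

/-! Everything is compared with `Φ ⊗̂ Φ`. As a set `C(Φ)` is `Φ`, because `C` preserves `Φ` and `C²
= 1`; the carried topology is also that of `Φ`, because `C` is continuous there. Hence `Φ_TFD` and
`Φ_𝔏` are both copies of `Φ ⊗̂ Φ`, their maps to the Hilbert spaces differ only by `U`, and `Λ` is
the resulting identification.

The unitary `U` comes from `(φ, χ) ↦ ⟨C χ, ·⟩ φ`, which is bilinear because `C` is antilinear and
isometric on tensors because `⟨C x, C y⟩ = ⟨y, x⟩`. It is onto: an operator `A` orthogonal to all
rank-one operators satisfies `‖A ψ‖² = 0` for every `ψ`.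

The analytic core is that `Φ ⊗̂ Φ` is again nuclear and injects into the Hilbert tensor product. A
continuous map on `E ⊗̂ F` is a bilinear map that factors through two local Banach spaces;
multiplying the nuclear expansions of the two canonical maps expands it in functionals `f ⊗ g`
(`CompletedTensor.exists_expansion`). This gives nuclearity, and also shows that the functionals `f
⊗ g` separate points. The Hilbert inner product only sees those with `f`, `g` bras; slice maps into
the complete spaces `E` and `F` remove this restriction one factor at a time
(`tensorIncl_injective`).

The dual statements concern the transpose of `Λ⁻¹`. Uniqueness holds because bras (kets) of test
vectors are weak-* dense: by Riesz in finite dimension, any functional agrees with one of them on a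
given finite set. -/

theorem LinearMap.continuous_of_norm_le_seminorm [TopologicalSpace E] [IsTopologicalAddGroup E]
    {B : Type*} [SeminormedAddCommGroup B] [NormedSpace ℂ B] (f : E →ₗ[ℂ] B) (p : Seminorm ℂ E)
    (hp : Continuous p) (h : ∀ x, ‖f x‖ ≤ p x) : Continuous f := by
  refine continuous_of_continuousAt_zero f ?_
  rw [ContinuousAt, map_zero]
  exact squeeze_zero_norm h (by simpa using hp.tendsto 0)

theorem PolynormableSpace.exists_seminorm_subset [TopologicalSpace E] [PolynormableSpace ℂ E]
    {U : Set E} (hU : U ∈ 𝓝 (0 : E)) :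
    ∃ p : Seminorm ℂ E, Continuous p ∧ ∀ x, p x < 1 → x ∈ U := by
  have hws := PolynormableSpace.withSeminorms ℂ E
  have := hws.topologicalAddGroup
  obtain ⟨s, r, hr, hs⟩ := (hws.mem_nhds_iff 0 U).1 hU
  have hc : Continuous (s.sup fun p : {p : Seminorm ℂ E // Continuous p} => p.1 : Seminorm ℂ E) :=
    Seminorm.continuous_finsetSup fun i _ => i.2
  -- Scaling by `r⁻¹` turns the ball of radius `r` into the unit ball.
  refine ⟨r⁻¹.toNNReal • s.sup fun p : {p : Seminorm ℂ E // Continuous p} => p.1, ?_, ?_⟩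
  · exact continuous_const.mul hc
  · intro x hx
    apply hs
    rw [Seminorm.mem_ball_zero]
    have hx' : (r⁻¹.toNNReal : ℝ) * (s.sup fun p : {p : Seminorm ℂ E // Continuous p} => p.1) x < 1 :=
      hx
    rwa [Real.coe_toNNReal _ (inv_nonneg.2 hr.le), inv_mul_lt_iff₀ hr, mul_one] at hx'

theorem PolynormableSpace.of_exists_seminorm_subset [TopologicalSpace E] [IsTopologicalAddGroup E]
    (h : ∀ U ∈ 𝓝 (0 : E), ∃ p : Seminorm ℂ E, Continuous p ∧ ∀ x, p x < 1 → x ∈ U) :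
    PolynormableSpace ℂ E where
  withSeminorms' := by
    rw [SeminormFamily.withSeminorms_iff_nhds_eq_iInf]
    refine le_antisymm ?_ fun U hU => ?_
    · simp_rw [le_iInf_iff, ← tendsto_iff_comap]
      intro ⟨p, hp⟩
      exact hp.tendsto' 0 0 (map_zero _)
    · obtain ⟨p, hp, hpU⟩ := h U hU
      exact mem_iInf_of_mem (⟨p, hp⟩ : {p : Seminorm ℂ E // Continuous p})
        ⟨Set.Iio 1, Iio_mem_nhds (by simp), fun x hx => hpU x hx⟩

theorem PolynormableSpace.eq_zero_of_seminorm [TopologicalSpace E] [T1Space E]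
    [PolynormableSpace ℂ E] {x : E} (h : ∀ p : Seminorm ℂ E, Continuous p → p x = 0) : x = 0 := by
  by_contra hx
  obtain ⟨p, hp, hpU⟩ := PolynormableSpace.exists_seminorm_subset
    (isOpen_compl_singleton.mem_nhds (Ne.symm hx) : ({x}ᶜ : Set E) ∈ 𝓝 0)
  exact hpU x (by rw [h p hp]; exact one_pos) rfl

/-- The space `E` with the topology of the single seminorm `p`. -/
def SeminormSpace (_p : Seminorm ℂ E) : Type _ := E

variable (p : Seminorm ℂ E)

instance : SeminormedAddCommGroup (SeminormSpace p) :=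
  p.toAddGroupSeminorm.toSeminormedAddCommGroup

instance : Module ℂ (SeminormSpace p) := inferInstanceAs (Module ℂ E)

instance : NormedSpace ℂ (SeminormSpace p) where
  norm_smul_le a x := (map_smul_eq_mul p a x).le

/-- The identity from `E` to the space with the single seminorm `p`. -/
def SeminormSpace.mk : E →ₗ[ℂ] SeminormSpace p where
  toFun x := x
  map_add' _ _ := rfl
  map_smul' _ _ := rfl

theorem SeminormSpace.norm_mk (x : E) : ‖SeminormSpace.mk p x‖ = p x := rfl

/-- The local Banach space of `E` at the seminorm `p`. -/
abbrev LocalBanach : Type _ := Completion (SeminormSpace p)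

variable {p}

/-- The canonical map from `E` to its local Banach space at `p`. -/
def toLocalBanach [TopologicalSpace E] [IsTopologicalAddGroup E] (hp : Continuous p) :
    E →L[ℂ] LocalBanach p :=
  (Completion.toComplL : SeminormSpace p →L[ℂ] LocalBanach p).comp
    ⟨SeminormSpace.mk p, (SeminormSpace.mk p).continuous_of_norm_le_seminorm p hp fun _ => le_rfl⟩

theorem toLocalBanach_apply [TopologicalSpace E] [IsTopologicalAddGroup E] (hp : Continuous p)
    (x : E) : toLocalBanach hp x = (SeminormSpace.mk p x : LocalBanach p) := rfl

theorem norm_toLocalBanach [TopologicalSpace E] [IsTopologicalAddGroup E] (hp : Continuous p)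
    (x : E) : ‖toLocalBanach hp x‖ = p x := by
  rw [toLocalBanach_apply, Completion.norm_coe, SeminormSpace.norm_mk]

/-- A bilinear map with `‖b x y‖ ≤ p x * q y` extends to the local Banach spaces. -/
theorem exists_localBanach_bilin {F B : Type*} [AddCommGroup F] [Module ℂ F]
    [TopologicalSpace E] [IsTopologicalAddGroup E] [TopologicalSpace F] [IsTopologicalAddGroup F]
    [NormedAddCommGroup B] [NormedSpace ℂ B] [CompleteSpace B] (b : E →ₗ[ℂ] F →ₗ[ℂ] B)
    {q : Seminorm ℂ F} (hp : Continuous p) (hq : Continuous q)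
    (hb : ∀ x y, ‖b x y‖ ≤ p x * q y) :
    ∃ β : LocalBanach p →L[ℂ] LocalBanach q →L[ℂ] B,
      ∀ x y, β (toLocalBanach hp x) (toLocalBanach hq y) = b x y := by
  let b₀ : SeminormSpace p →ₗ[ℂ] SeminormSpace q →ₗ[ℂ] B := b
  let b₁ : SeminormSpace p →L[ℂ] SeminormSpace q →L[ℂ] B :=
    b₀.mkContinuous₂ 1 fun x y => by rw [one_mul]; exact hb x y
  -- A linear map into a complete space extends to the completion; the flips allow this to be done
  -- in one variable at a time.
  let b₂ : SeminormSpace q →L[ℂ] LocalBanach p →L[ℂ] B := b₁.fromCompletion.flip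
  refine ⟨b₂.fromCompletion.flip, fun x y => ?_⟩
  rw [ContinuousLinearMap.flip_apply, toLocalBanach_apply, toLocalBanach_apply,
    ContinuousLinearMap.fromCompletion_apply_coe, ContinuousLinearMap.flip_apply,
    ContinuousLinearMap.fromCompletion_apply_coe]
  rfl

/-- A seminorm `p` on `E` extends to the completion as the norm of the extended map to the local
Banach space at `p`. If the unit ball of `p` lies in a closed neighbourhood `V`, so does the
extended open ball, since `E` is dense in it. -/
theorem PolynormableSpace.completion {E : Type*} [AddCommGroup E] [Module ℂ E] [UniformSpace E]
    [IsUniformAddGroup E] [UniformContinuousConstSMul ℂ E] [PolynormableSpace ℂ E] :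
    PolynormableSpace ℂ (Completion E) := by
  refine PolynormableSpace.of_exists_seminorm_subset fun U hU => ?_
  obtain ⟨V, hV, hVc, hVU⟩ := exists_mem_nhds_isClosed_subset hU
  have hV' : ((↑) : E → Completion E) ⁻¹' V ∈ 𝓝 (0 : E) :=
    (Completion.continuous_coe E).continuousAt (by rwa [Completion.coe_zero])
  obtain ⟨p, hp, hpV⟩ := PolynormableSpace.exists_seminorm_subset hV'
  let T : Completion E →L[ℂ] LocalBanach p := (toLocalBanach hp).fromCompletion
  refine ⟨(normSeminorm ℂ (LocalBanach p)).comp (T : Completion E →ₗ[ℂ] LocalBanach p),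
    T.continuous.norm, fun z hz => hVU ?_⟩
  have hz : ‖T z‖ < 1 := hz
  have hO : IsOpen {w : Completion E | ‖T w‖ < 1} := isOpen_lt T.continuous.norm continuous_const
  refine hVc.closure_subset_iff.2 ?_ (Completion.denseRange_coe.open_subset_closure_inter hO hz)
  rintro _ ⟨hw, x, rfl⟩
  refine hpV x ?_
  have hw : ‖T x‖ < 1 := hw
  rwa [ContinuousLinearMap.fromCompletion_apply_coe, norm_toLocalBanach] at hw

end Seminorms

/-! ### Continuous linear maps on projective tensor products -/

section Projective

variable {E F : Type*} [AddCommGroup E] [Module ℂ E] [TopologicalSpace E]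
  [AddCommGroup F] [Module ℂ F] [TopologicalSpace F]

theorem ProjTensor.induction_on {P : ProjTensor E F → Prop} (t : ProjTensor E F) (h0 : P 0)
    (hmk : ∀ x y, P (ProjTensor.mk x y)) (hadd : ∀ s t, P s → P t → P (s + t)) : P t :=
  TensorProduct.induction_on (motive := P) t h0 hmk hadd

/-- The canonical bilinear map `E × F → E ⊗ F`. -/
def ProjTensor.mkₗ : E →ₗ[ℂ] F →ₗ[ℂ] ProjTensor E F := TensorProduct.mk ℂ E F

@[simp]
theorem ProjTensor.mkₗ_apply (x : E) (y : F) : ProjTensor.mkₗ x y = ProjTensor.mk x y := rfl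

/-- The linear map on `E ⊗ F` defined by a jointly continuous bilinear map. -/
def ProjTensor.lift {G : Type*} [AddCommGroup G] [Module ℂ G] [TopologicalSpace G]
    [PolynormableSpace ℂ G] (b : E →ₗ[ℂ] F →ₗ[ℂ] G) (hb : Continuous fun z : E × F => b z.1 z.2) :
    ProjTensor E F →L[ℂ] G where
  toLinearMap := (TensorProduct.lift b : E ⊗[ℂ] F →ₗ[ℂ] G)
  cont := by
    let T : ProjTensor E F →ₗ[ℂ] G := (TensorProduct.lift b : E ⊗[ℂ] F →ₗ[ℂ] G)
    refine (withSeminorms_projSeminorms E F).continuous_of_isBounded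
      (PolynormableSpace.withSeminorms ℂ G) T fun q => ?_
    -- The pullback of a continuous seminorm is itself one of the seminorms that define the
    -- projective topology, so the bound holds with constant 1.
    have hT : Continuous fun z : E × F => (q.1.comp T) (ProjTensor.mk z.1 z.2) := q.2.comp hb
    exact ⟨{⟨_, hT⟩}, 1, by simp [projSeminorms]⟩

@[simp]
theorem ProjTensor.lift_mk {G : Type*} [AddCommGroup G] [Module ℂ G] [TopologicalSpace G]
    [PolynormableSpace ℂ G] (b : E →ₗ[ℂ] F →ₗ[ℂ] G) (hb : Continuous fun z : E × F => b z.1 z.2)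
    (x : E) (y : F) : ProjTensor.lift b hb (ProjTensor.mk x y) = b x y :=
  TensorProduct.lift.tmul x y

instance : PolynormableSpace ℂ (ProjTensor E F) :=
  (withSeminorms_projSeminorms E F).toPolynormableSpace

/-- The defining seminorms are only known to be continuous along elementary tensors, so the
difference is split as `x ⊗ y - x₀ ⊗ y₀ = (x - x₀) ⊗ y + x₀ ⊗ (y - y₀)`. -/
theorem ProjTensor.continuous_mk [IsTopologicalAddGroup E] [IsTopologicalAddGroup F] :
    Continuous fun z : E × F => ProjTensor.mk z.1 z.2 := by
  rw [continuous_iff_continuousAt]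
  rintro ⟨x₀, y₀⟩
  refine ((withSeminorms_projSeminorms E F).tendsto_nhds _ _).2 fun r ε hε => ?_
  have hr := r.2
  have h1 : Tendsto (fun z : E × F => r.1 (ProjTensor.mk (z.1 - x₀) z.2)
      + r.1 (ProjTensor.mk x₀ (z.2 - y₀))) (𝓝 (x₀, y₀)) (𝓝 0) := by
    have ha : Continuous fun z : E × F => r.1 (ProjTensor.mk (z.1 - x₀) z.2) :=
      hr.comp (f := fun z : E × F => (z.1 - x₀, z.2)) (by fun_prop)
    have hb : Continuous fun z : E × F => r.1 (ProjTensor.mk x₀ (z.2 - y₀)) :=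
      hr.comp (f := fun z : E × F => (x₀, z.2 - y₀)) (by fun_prop)
    refine (ha.add hb).tendsto' _ _ ?_
    simp [← ProjTensor.mkₗ_apply]
  filter_upwards [h1.eventually (gt_mem_nhds hε)] with z hz
  refine lt_of_le_of_lt ?_ hz
  have e : ProjTensor.mk z.1 z.2 - ProjTensor.mk x₀ y₀
      = ProjTensor.mk (z.1 - x₀) z.2 + ProjTensor.mk x₀ (z.2 - y₀) := by
    simp [← ProjTensor.mkₗ_apply]
  rw [e]
  exact map_add_le_add r.1 _ _

/-- Continuity at the origin bounds `r (x ⊗ y)` on a product of unit balls of `p` and `q`;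
homogeneity in each variable does the rest. -/
theorem ProjTensor.exists_seminorm_mul_bound [IsTopologicalAddGroup E] [IsTopologicalAddGroup F]
    [PolynormableSpace ℂ E] [PolynormableSpace ℂ F] {r : Seminorm ℂ (ProjTensor E F)}
    (hr : Continuous r) : ∃ (p : Seminorm ℂ E) (q : Seminorm ℂ F), Continuous p ∧ Continuous q ∧
      ∀ x y, r (ProjTensor.mk x y) ≤ p x * q y := by
  have hc : Continuous fun z : E × F => r (ProjTensor.mk z.1 z.2) :=
    hr.comp ProjTensor.continuous_mk
  have h0 : {z : E × F | r (ProjTensor.mk z.1 z.2) < 1} ∈ 𝓝 ((0 : E), (0 : F)) :=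
    (isOpen_lt hc continuous_const).mem_nhds (by simp [← ProjTensor.mkₗ_apply])
  rw [nhds_prod_eq, mem_prod_iff] at h0
  obtain ⟨U, hU, V, hV, hUV⟩ := h0
  obtain ⟨p, hp, hpU⟩ := PolynormableSpace.exists_seminorm_subset hU
  obtain ⟨q, hq, hqV⟩ := PolynormableSpace.exists_seminorm_subset hV
  refine ⟨p, q, hp, hq, fun x y => ?_⟩
  -- `p x` and `q y` may vanish, so the vectors are normalized by `p x + ε` and `q y + ε`.
  have key : ∀ ε : ℝ, 0 < ε → r (ProjTensor.mk x y) ≤ (p x + ε) * (q y + ε) := by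
    intro ε hε
    have ha : 0 < p x + ε := add_pos_of_nonneg_of_pos (apply_nonneg p x) hε
    have hb : 0 < q y + ε := add_pos_of_nonneg_of_pos (apply_nonneg q y) hε
    have hx : (((p x + ε)⁻¹ : ℝ) : ℂ) • x ∈ U := by
      apply hpU
      rw [map_smul_eq_mul, Complex.norm_real, Real.norm_of_nonneg (inv_nonneg.2 ha.le),
        inv_mul_lt_iff₀ ha]
      linarith
    have hy : (((q y + ε)⁻¹ : ℝ) : ℂ) • y ∈ V := by
      apply hqV
      rw [map_smul_eq_mul, Complex.norm_real, Real.norm_of_nonneg (inv_nonneg.2 hb.le),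
        inv_mul_lt_iff₀ hb]
      linarith
    have h1 : r (ProjTensor.mk ((((p x + ε)⁻¹ : ℝ) : ℂ) • x) ((((q y + ε)⁻¹ : ℝ) : ℂ) • y)) < 1 :=
      hUV (Set.mk_mem_prod hx hy)
    rw [← ProjTensor.mkₗ_apply, LinearMap.map_smul, LinearMap.map_smul, LinearMap.smul_apply,
      map_smul_eq_mul,
      map_smul_eq_mul, Complex.norm_real, Complex.norm_real,
      Real.norm_of_nonneg (inv_nonneg.2 ha.le), Real.norm_of_nonneg (inv_nonneg.2 hb.le),
      ProjTensor.mkₗ_apply, inv_mul_lt_iff₀ hb, inv_mul_lt_iff₀ ha] at h1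
    linarith
  have hlim : Tendsto (fun ε : ℝ => (p x + ε) * (q y + ε)) (𝓝[>] 0) (𝓝 (p x * q y)) := by
    have : Continuous fun ε : ℝ => (p x + ε) * (q y + ε) := by fun_prop
    exact (this.tendsto' 0 _ (by simp)).mono_left nhdsWithin_le_nhds
  exact ge_of_tendsto hlim (eventually_nhdsWithin_of_forall key)

/-- The elementary tensor `x ⊗ y` in the completed tensor product. -/
def CompletedTensor.mk (x : E) (y : F) : CompletedTensor E F :=
  (ProjTensor.mk x y : Completion (ProjTensor E F))

instance : PolynormableSpace ℂ (CompletedTensor E F) := PolynormableSpace.completion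

theorem CompletedTensor.ext {G : Type*} [AddCommGroup G] [Module ℂ G] [TopologicalSpace G]
    [T2Space G] {S T : CompletedTensor E F →L[ℂ] G}
    (h : ∀ x y, S (CompletedTensor.mk x y) = T (CompletedTensor.mk x y)) (z : CompletedTensor E F) :
    S z = T z := by
  refine Completion.induction_on z (isClosed_eq S.continuous T.continuous) fun t => ?_
  refine ProjTensor.induction_on (P := fun t => S (t : Completion (ProjTensor E F)) = T t) t
    ?_ h fun s t hs ht => ?_
  · rw [Completion.coe_zero, map_zero, map_zero]
  · rw [Completion.coe_add, map_add, map_add, hs, ht]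

/-- The bilinear form `(x, y) ↦ f x * g y`. -/
def mulForm (f : E →L[ℂ] ℂ) (g : F →L[ℂ] ℂ) : E →ₗ[ℂ] F →ₗ[ℂ] ℂ :=
  (LinearMap.mul ℂ ℂ).compl₁₂ (f : E →ₗ[ℂ] ℂ) (g : F →ₗ[ℂ] ℂ)

/-- The functional `f ⊗ g` on the completed tensor product. -/
def CompletedTensor.functional (f : E →L[ℂ] ℂ) (g : F →L[ℂ] ℂ) : CompletedTensor E F →L[ℂ] ℂ :=
  (ProjTensor.lift (mulForm f g) (by
    change Continuous fun z : E × F => f z.1 * g z.2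
    fun_prop)).fromCompletion

@[simp]
theorem CompletedTensor.functional_mk (f : E →L[ℂ] ℂ) (g : F →L[ℂ] ℂ) (x : E) (y : F) :
    CompletedTensor.functional f g (CompletedTensor.mk x y) = f x * g y := by
  rw [CompletedTensor.functional, CompletedTensor.mk, ContinuousLinearMap.fromCompletion_apply_coe,
    ProjTensor.lift_mk]
  rfl

end Projective

/-! ### Equicontinuous sequences of functionals -/

section Equicontinuous

open BoundedContinuousFunction

variable {E : Type*} [AddCommGroup E] [Module ℂ E] [TopologicalSpace E] [IsTopologicalAddGroup E]

/-- An equicontinuous sequence of functionals, as a map to the space of bounded sequences. -/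
theorem exists_toBoundedSeq (f : ℕ → E →L[ℂ] ℂ) (p : Seminorm ℂ E) (hp : Continuous p)
    (hf : ∀ n x, ‖f n x‖ ≤ p x) : ∃ T : E →L[ℂ] (ℕ →ᵇ ℂ), ∀ x n, T x n = f n x := by
  let T : E →ₗ[ℂ] (ℕ →ᵇ ℂ) :=
    { toFun := fun x => ofNormedAddCommGroupDiscrete (fun n => f n x) (p x) fun n => hf n x
      map_add' := fun x y => by ext n; simp
      map_smul' := fun a x => by ext n; simp }
  refine ⟨⟨T, T.continuous_of_norm_le_seminorm p hp fun x => ?_⟩, fun x n => rfl⟩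
  exact (norm_le (apply_nonneg p x)).2 fun n => hf n x

/-- The map `v ↦ ∑ₙ cₙ vₙ wₙ` on bounded sequences. -/
theorem exists_boundedSeq_sum {B : Type*} [NormedAddCommGroup B] [NormedSpace ℂ B]
    [CompleteSpace B] (c : ℕ → ℂ) (w : ℕ → B) (M : ℝ) (hc : Summable fun n => ‖c n‖)
    (hw : ∀ n, ‖w n‖ ≤ M) :
    ∃ S : (ℕ →ᵇ ℂ) →L[ℂ] B, ∀ v, HasSum (fun n => (c n * v n) • w n) (S v) := by
  have hb : ∀ (v : ℕ →ᵇ ℂ) n, ‖(c n * v n) • w n‖ ≤ ‖c n‖ * (‖v‖ * M) := fun v n => by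
    rw [norm_smul, norm_mul, mul_assoc]
    gcongr
    · exact v.norm_coe_le_norm n
    · exact hw n
  have hs : ∀ v : ℕ →ᵇ ℂ, Summable fun n => (c n * v n) • w n := fun v =>
    Summable.of_norm_bounded (hc.mul_right _) (hb v)
  let S : (ℕ →ᵇ ℂ) →ₗ[ℂ] B :=
    { toFun := fun v => ∑' n, (c n * v n) • w n
      map_add' := fun v v' => by
        rw [← (hs v).tsum_add (hs v')]
        exact tsum_congr fun n => by simp [mul_add, add_smul]
      map_smul' := fun a v => by
        rw [RingHom.id_apply, ← (hs v).tsum_const_smul]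
        exact tsum_congr fun n => by simp [smul_smul, mul_left_comm] }
  refine ⟨S.mkContinuous ((∑' n, ‖c n‖) * M) fun v => ?_, fun v => (hs v).hasSum⟩
  calc ‖S v‖ ≤ ∑' n, ‖c n‖ * (‖v‖ * M) :=
        tsum_of_norm_bounded (hc.mul_right _).hasSum (hb v)
    _ = (∑' n, ‖c n‖) * M * ‖v‖ := by rw [tsum_mul_right]; ring

end Equicontinuous

/-! ### Completed tensor products of nuclear spaces -/

section Nuclear

open BoundedContinuousFunction

/-- A continuous linear map on `E ⊗̂ F`, with `E` and `F` nuclear, is a sum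
`∑ₙ cₙ (fₙ ⊗ gₙ)(·) wₙ`. -/
theorem CompletedTensor.exists_expansion {E F : Type u} [AddCommGroup E] [Module ℂ E]
    [TopologicalSpace E] [IsTopologicalAddGroup E] [PolynormableSpace ℂ E] [AddCommGroup F]
    [Module ℂ F] [TopologicalSpace F] [IsTopologicalAddGroup F] [PolynormableSpace ℂ F]
    (hE : IsNuclear E) (hF : IsNuclear F) {B : Type*} [NormedAddCommGroup B] [NormedSpace ℂ B]
    [CompleteSpace B] (u : CompletedTensor E F →L[ℂ] B) :
    ∃ (c : ℕ → ℂ) (f : ℕ → E →L[ℂ] ℂ) (g : ℕ → F →L[ℂ] ℂ) (w : ℕ → B),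
      Summable (fun n => ‖c n‖) ∧
      (∃ P : Seminorm ℂ (CompletedTensor E F), Continuous P ∧
        ∀ n z, ‖CompletedTensor.functional (f n) (g n) z‖ ≤ P z) ∧
      (∃ M : ℝ, ∀ n, ‖w n‖ ≤ M) ∧
      ∀ z, HasSum (fun n => (c n * CompletedTensor.functional (f n) (g n) z) • w n) (u z) := by
  let u₀ : ProjTensor E F →ₗ[ℂ] B :=
    { toFun := fun t => u (t : Completion (ProjTensor E F))
      map_add' := fun s t => by rw [Completion.coe_add, map_add]
      map_smul' := fun a t => by rw [Completion.coe_smul, map_smul, RingHom.id_apply] }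
  have hu₀ : Continuous fun t => ‖u₀ t‖ := (u.continuous.comp (Completion.continuous_coe _)).norm
  obtain ⟨p, q, hp, hq, hpq⟩ := ProjTensor.exists_seminorm_mul_bound
    (r := (normSeminorm ℂ B).comp u₀) hu₀
  obtain ⟨β, hβ⟩ := exists_localBanach_bilin (ProjTensor.mkₗ.compr₂ u₀) hp hq hpq
  -- Nuclearity is applied to the canonical maps and not to `u`: the local Banach spaces lie in the
  -- universe of `E` and `F`, whereas `B` need not.
  obtain ⟨c, f, ξ, hc, ⟨p', hp', hf⟩, ⟨M, hM⟩, hsum⟩ := hE _ (toLocalBanach hp)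
  obtain ⟨d, g, η, hd, ⟨q', hq', hg⟩, ⟨N, hN⟩, hsum'⟩ := hF _ (toLocalBanach hq)
  -- The product of the two expansions is indexed by pairs; `e` makes it a single sequence.
  let e : ℕ ≃ ℕ × ℕ := Nat.pairEquiv.symm
  have hcd : Summable fun n => ‖c (e n).1 * d (e n).2‖ := by
    have := (e.summable_iff (f := fun k : ℕ × ℕ => ‖c k.1‖ * ‖d k.2‖)).2
      (hc.mul_of_nonneg hd (fun _ => norm_nonneg _) fun _ => norm_nonneg _)
    simpa only [norm_mul, Function.comp_def] using this
  have hM0 : 0 ≤ M := (norm_nonneg _).trans (hM 0)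
  have hw : ∀ n, ‖β (ξ (e n).1) (η (e n).2)‖ ≤ ‖β‖ * M * N := fun n => by
    refine (β.le_opNorm₂ _ _).trans ?_
    gcongr
    · exact hM _
    · exact hN _
  -- `u` will be factored as `S ∘ T` through bounded sequences, where `T z` lists the values `(f ⊗
  -- g)(z)`. Continuity of `T` is the required equicontinuity, and `S ∘ T = u` need only be checked
  -- on elementary tensors.
  obtain ⟨Tf, hTf⟩ := exists_toBoundedSeq (fun n => f (e n).1) p' hp' fun n x => hf _ x
  obtain ⟨Tg, hTg⟩ := exists_toBoundedSeq (fun n => g (e n).2) q' hq' fun n x => hg _ x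
  obtain ⟨S, hS⟩ := exists_boundedSeq_sum _ _ _ hcd hw
  let b : E →ₗ[ℂ] F →ₗ[ℂ] (ℕ →ᵇ ℂ) :=
    (LinearMap.mul ℂ (ℕ →ᵇ ℂ)).compl₁₂ (Tf : E →ₗ[ℂ] (ℕ →ᵇ ℂ)) (Tg : F →ₗ[ℂ] (ℕ →ᵇ ℂ))
  have hb : Continuous fun z : E × F => b z.1 z.2 := by
    change Continuous fun z : E × F => Tf z.1 * Tg z.2
    fun_prop
  let T : CompletedTensor E F →L[ℂ] (ℕ →ᵇ ℂ) := (ProjTensor.lift b hb).fromCompletion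
  have hT : ∀ x y n, T (CompletedTensor.mk x y) n = f (e n).1 x * g (e n).2 y := fun x y n => by
    have h : T (CompletedTensor.mk x y) = Tf x * Tg y := by
      change (ProjTensor.lift b hb).fromCompletion (ProjTensor.mk x y : Completion _) = _
      rw [ContinuousLinearMap.fromCompletion_apply_coe, ProjTensor.lift_mk]
      rfl
    rw [h, BoundedContinuousFunction.mul_apply, hTf, hTg]
  have hfun : ∀ z n, T z n = CompletedTensor.functional (f (e n).1) (g (e n).2) z := fun z n =>
    CompletedTensor.ext (S := (BoundedContinuousFunction.evalCLM ℂ n).comp T)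
      (fun x y => by simp [hT]) z
  have hST : ∀ z, S (T z) = u z := CompletedTensor.ext (S := S.comp T) fun x y => by
    -- The double sum equals the iterated one: summing over the second index rebuilds the image of
    -- `y`, then summing over the first rebuilds that of `x`.
    have h1 : HasSum (fun k : ℕ × ℕ => (c k.1 * d k.2 * (f k.1 x * g k.2 y)) • β (ξ k.1) (η k.2))
        (S (T (CompletedTensor.mk x y))) := by
      rw [← e.hasSum_iff]
      convert hS (T (CompletedTensor.mk x y)) using 2 with n
      simp [hT]
    have h2 : ∀ n, HasSum
        (fun m => (c n * d m * (f n x * g m y)) • β (ξ n) (η m))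
        ((c n * f n x) • β (ξ n) (toLocalBanach hq y)) := fun n => by
      convert ((hsum' y).mapL (β (ξ n))).const_smul (c n * f n x) using 2 with m
      rw [map_smul, smul_smul]
      congr 1
      ring
    have h3 : HasSum (fun n => (c n * f n x) • β (ξ n) (toLocalBanach hq y))
        (β (toLocalBanach hp x) (toLocalBanach hq y)) := by
      convert (hsum x).mapL (β.flip (toLocalBanach hq y)) using 2 with n
      · simp
      · rfl
    have h4 := (h1.prod_fiberwise h2).unique h3
    rw [hβ] at h4
    exact h4
  refine ⟨fun n => c (e n).1 * d (e n).2, fun n => f (e n).1, fun n => g (e n).2,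
    fun n => β (ξ (e n).1) (η (e n).2), hcd,
    ⟨(normSeminorm ℂ (ℕ →ᵇ ℂ)).comp (T : CompletedTensor E F →ₗ[ℂ] (ℕ →ᵇ ℂ)), T.continuous.norm,
      fun n z => ?_⟩, ⟨_, hw⟩, fun z => ?_⟩
  · rw [← hfun]
    exact (T z).norm_coe_le_norm n
  · simp only [← hfun, ← hST]
    exact hS (T z)

theorem IsNuclear.completedTensor {E F : Type u} [AddCommGroup E] [Module ℂ E]
    [TopologicalSpace E] [IsTopologicalAddGroup E] [PolynormableSpace ℂ E] [AddCommGroup F]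
    [Module ℂ F] [TopologicalSpace F] [IsTopologicalAddGroup F] [PolynormableSpace ℂ F]
    (hE : IsNuclear E) (hF : IsNuclear F) : IsNuclear (CompletedTensor E F) := by
  intro B _ _ _ u
  obtain ⟨c, f, g, w, hc, hP, hw, hsum⟩ := CompletedTensor.exists_expansion hE hF u
  exact ⟨c, fun n => CompletedTensor.functional (f n) (g n), w, hc, hP, hw, hsum⟩

/-- An element of `E ⊗̂ F` with `E` and `F` nuclear is determined by the functionals `f ⊗ g`. -/
theorem CompletedTensor.eq_zero_of_functional {E F : Type u} [AddCommGroup E] [Module ℂ E]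
    [TopologicalSpace E] [IsTopologicalAddGroup E] [PolynormableSpace ℂ E] [AddCommGroup F]
    [Module ℂ F] [TopologicalSpace F] [IsTopologicalAddGroup F] [PolynormableSpace ℂ F]
    (hE : IsNuclear E) (hF : IsNuclear F) {z : CompletedTensor E F}
    (hz : ∀ f g, CompletedTensor.functional f g z = 0) : z = 0 := by
  refine PolynormableSpace.eq_zero_of_seminorm fun p hp => ?_
  -- Every term in the expansion of the map to the local Banach space at `p` vanishes at `z`, hence
  -- `p z = 0`.
  obtain ⟨c, f, g, w, -, -, -, hsum⟩ := CompletedTensor.exists_expansion hE hF (toLocalBanach hp)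
  rw [← norm_toLocalBanach hp, (hsum z).unique (a₂ := 0) (by simp [hz, hasSum_zero]), norm_zero]

end Nuclear

/-! ### Slice maps and injectivity of the canonical map into the Hilbert tensor product. -/

section Inclusion

variable {E F : Type*} [AddCommGroup E] [Module ℂ E] [TopologicalSpace E] [AddCommGroup F]
  [Module ℂ F] [TopologicalSpace F]

/-- The slice map `1 ⊗ g : E ⊗̂ F → E` of a functional `g`, for complete `E`. -/
theorem CompletedTensor.exists_slice_right [IsTopologicalAddGroup E]
    [PolynormableSpace ℂ E] [T2Space E]
    (hE : @CompleteSpace E (IsTopologicalAddGroup.rightUniformSpace E)) (g : F →L[ℂ] ℂ) :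
    ∃ T : CompletedTensor E F →L[ℂ] E, ∀ x y, T (CompletedTensor.mk x y) = g y • x := by
  let := IsTopologicalAddGroup.rightUniformSpace E
  have : IsUniformAddGroup E := isUniformAddGroup_of_addCommGroup
  have : ContinuousSMul ℂ E := (PolynormableSpace.withSeminorms ℂ E).continuousSMul
  have : UniformContinuousConstSMul ℂ E := uniformContinuousConstSMul_of_continuousConstSMul _ _
  let b : E →ₗ[ℂ] F →ₗ[ℂ] E := ((LinearMap.lsmul ℂ E).comp (g : F →ₗ[ℂ] ℂ)).flip
  have hb : Continuous fun z : E × F => b z.1 z.2 := by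
    change Continuous fun z : E × F => g z.2 • z.1
    fun_prop
  refine ⟨(ProjTensor.lift b hb).fromCompletion, fun x y => ?_⟩
  rw [CompletedTensor.mk, ContinuousLinearMap.fromCompletion_apply_coe, ProjTensor.lift_mk]
  rfl

/-- The slice map `f ⊗ 1 : E ⊗̂ F → F` of a functional `f`, for complete `F`. -/
theorem CompletedTensor.exists_slice_left [IsTopologicalAddGroup F]
    [PolynormableSpace ℂ F] [T2Space F]
    (hF : @CompleteSpace F (IsTopologicalAddGroup.rightUniformSpace F)) (f : E →L[ℂ] ℂ) :
    ∃ T : CompletedTensor E F →L[ℂ] F, ∀ x y, T (CompletedTensor.mk x y) = f x • y := by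
  let := IsTopologicalAddGroup.rightUniformSpace F
  have : IsUniformAddGroup F := isUniformAddGroup_of_addCommGroup
  have : ContinuousSMul ℂ F := (PolynormableSpace.withSeminorms ℂ F).continuousSMul
  have : UniformContinuousConstSMul ℂ F := uniformContinuousConstSMul_of_continuousConstSMul _ _
  let b : E →ₗ[ℂ] F →ₗ[ℂ] F := (LinearMap.lsmul ℂ F).comp (f : E →ₗ[ℂ] ℂ)
  have hb : Continuous fun z : E × F => b z.1 z.2 := by
    change Continuous fun z : E × F => f z.1 • z.2
    fun_prop
  refine ⟨(ProjTensor.lift b hb).fromCompletion, fun x y => ?_⟩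
  rw [CompletedTensor.mk, ContinuousLinearMap.fromCompletion_apply_coe, ProjTensor.lift_mk]
  rfl

variable {H K : Type*} [NormedAddCommGroup H] [InnerProductSpace ℂ H] [NormedAddCommGroup K]
  [InnerProductSpace ℂ K]

theorem eq_zero_of_braFunctional {ι : E →L[ℂ] H} (hι : Function.Injective ι) {x : E}
    (hx : ∀ v, braFunctional ι v x = 0) : x = 0 :=
  hι ((inner_self_eq_zero (𝕜 := ℂ)).1 (hx (ι x)) |>.trans (map_zero ι).symm)

@[simp]
theorem tensorIncl_mk (ι : E →L[ℂ] H) (κ : F →L[ℂ] K) (x : E) (y : F) :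
    tensorIncl ι κ (CompletedTensor.mk x y) = HilbertTensor.mk (ι x) (κ y) := by
  rw [tensorIncl, CompletedTensor.mk, ContinuousLinearMap.completion_apply_coe]
  rfl

/-- Links the kernel of the canonical map to the functionals `f ⊗ g`, but only for bras `f` and `g`.
-/
theorem inner_mk_tensorIncl (ι : E →L[ℂ] H) (κ : F →L[ℂ] K) (h : H) (k : K)
    (z : CompletedTensor E F) : ⟪HilbertTensor.mk h k, tensorIncl ι κ z⟫_ℂ
      = CompletedTensor.functional (braFunctional ι h) (braFunctional κ k) z := by
  refine CompletedTensor.ext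
    (S := (innerSL ℂ (HilbertTensor.mk h k)).comp (tensorIncl ι κ)) (fun x y => ?_) z
  rw [ContinuousLinearMap.comp_apply, tensorIncl_mk, CompletedTensor.functional_mk,
    innerSL_apply_apply, HilbertTensor.mk, HilbertTensor.mk, Completion.inner_coe,
    TensorProduct.inner_tmul]
  rfl

end Inclusion

/-- If `z` maps to 0, then `f ⊗ g` kills `z` for all bras `f`, `g`. Bras separate the points of `E`
and `F`, so slices of `z`, being vectors of these complete spaces, can be shown to vanish; a
vanishing slice is killed by every continuous functional, not only by bras. -/
theorem tensorIncl_injective {E F : Type u} [AddCommGroup E] [Module ℂ E] [TopologicalSpace E]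
    [AddCommGroup F] [Module ℂ F] [TopologicalSpace F] {H K : Type*} [NormedAddCommGroup H]
    [InnerProductSpace ℂ H] [NormedAddCommGroup K] [InnerProductSpace ℂ K] {ι : E →L[ℂ] H}
    {κ : F →L[ℂ] K} (hι : IsRiggedHilbertSpace ι) (hκ : IsRiggedHilbertSpace κ) :
    Function.Injective (tensorIncl ι κ) := by
  have := hι.isTopologicalAddGroup
  have := hκ.isTopologicalAddGroup
  have := hι.locallyConvex
  have := hκ.locallyConvex
  have : T2Space E := .of_injective_continuous hι.injective ι.continuous
  have : T2Space F := .of_injective_continuous hκ.injective κ.continuous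
  rw [injective_iff_map_eq_zero]
  intro z hz
  -- Arbitrary `f`, bra on the second factor: the slice of `z` in `E` is zero.
  have hslice : ∀ f g, CompletedTensor.functional f (braFunctional κ g) z = 0 := by
    intro f k
    obtain ⟨T, hT⟩ := CompletedTensor.exists_slice_right (F := F) hι.complete (braFunctional κ k)
    have hfT : ∀ f z, f (T z) = CompletedTensor.functional f (braFunctional κ k) z := fun f =>
      CompletedTensor.ext (S := f.comp T) fun x y => by simp [hT, mul_comm]
    have h0 : T z = 0 := eq_zero_of_braFunctional hι.injective fun h => by
      rw [hfT, ← inner_mk_tensorIncl, hz, inner_zero_right]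
    rw [← hfT, h0, map_zero]
  refine CompletedTensor.eq_zero_of_functional hι.nuclear hκ.nuclear fun f g => ?_
  -- Now `f` is arbitrary and fixed, and the slice in `F` frees the second functional.
  obtain ⟨T, hT⟩ := CompletedTensor.exists_slice_left (E := E) hκ.complete f
  have hgT : ∀ g z, g (T z) = CompletedTensor.functional f g z := fun g =>
    CompletedTensor.ext (S := g.comp T) fun x y => by simp [hT]
  have h0 : T z = 0 := eq_zero_of_braFunctional hκ.injective fun k => by rw [hgT, hslice]
  rw [← hgT, h0, map_zero]

/-! ### Density of the canonical image, and tensor products of rigged Hilbert spaces. -/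

section Dense

variable {H K : Type*} [NormedAddCommGroup H] [InnerProductSpace ℂ H] [NormedAddCommGroup K]
  [InnerProductSpace ℂ K]

/-- The canonical bilinear map `H × K → H ⊗̄ K`. -/
def HilbertTensor.mkₗ : H →ₗ[ℂ] K →ₗ[ℂ] HilbertTensor H K :=
  (TensorProduct.mk ℂ H K).compr₂ (Completion.toComplL : H ⊗[ℂ] K →L[ℂ] HilbertTensor H K)

theorem HilbertTensor.mkₗ_apply (x : H) (y : K) :
    HilbertTensor.mkₗ x y = HilbertTensor.mk x y := rfl

theorem HilbertTensor.norm_mk (x : H) (y : K) : ‖HilbertTensor.mk x y‖ = ‖x‖ * ‖y‖ := by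
  rw [HilbertTensor.mk, Completion.norm_coe, TensorProduct.norm_tmul]

theorem HilbertTensor.continuous_mk :
    Continuous fun z : H × K => HilbertTensor.mk z.1 z.2 :=
  ((HilbertTensor.mkₗ (H := H) (K := K)).mkContinuous₂ 1 fun x y => by
    rw [HilbertTensor.mkₗ_apply, HilbertTensor.norm_mk, one_mul]).continuous₂

theorem HilbertTensor.eq_top_of_isClosed {s : Submodule ℂ (HilbertTensor H K)}
    (hs : IsClosed (s : Set (HilbertTensor H K))) (h : ∀ x y, HilbertTensor.mk x y ∈ s) :
    s = ⊤ := by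
  refine eq_top_iff.2 fun z _ => Completion.induction_on z hs fun t => ?_
  induction t with
  | zero => rw [Completion.coe_zero]; exact zero_mem s
  | tmul x y => exact h x y
  | add a b ha hb => rw [Completion.coe_add]; exact add_mem ha hb

theorem denseRange_tensorIncl {E F : Type*} [AddCommGroup E] [Module ℂ E] [TopologicalSpace E]
    [AddCommGroup F] [Module ℂ F] [TopologicalSpace F] {ι : E →L[ℂ] H} {κ : F →L[ℂ] K}
    (hι : DenseRange ι) (hκ : DenseRange κ) : DenseRange (tensorIncl ι κ) := by
  let s : Submodule ℂ (HilbertTensor H K) :=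
    (LinearMap.range (tensorIncl ι κ : CompletedTensor E F →ₗ[ℂ] _)).topologicalClosure
  have hs : s = ⊤ := by
    refine HilbertTensor.eq_top_of_isClosed (Submodule.isClosed_topologicalClosure _)
      fun x y => ?_
    -- `s` is closed and `(x, y) ↦ x ⊗ y` is jointly continuous, so it suffices to take `x` and `y`
    -- in the dense images.
    refine (hι.prodMap hκ).induction_on (p := fun z : H × K => HilbertTensor.mk z.1 z.2 ∈ s) (x, y)
      ((Submodule.isClosed_topologicalClosure _).preimage HilbertTensor.continuous_mk) ?_
    rintro ⟨a, b⟩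
    refine Submodule.le_topologicalClosure _ ⟨CompletedTensor.mk a b, tensorIncl_mk ι κ a b⟩
  intro z
  have hz : z ∈ s := hs ▸ Submodule.mem_top
  exact hz

end Dense

theorem IsRiggedHilbertSpace.tensorIncl {E F : Type u} [AddCommGroup E] [Module ℂ E]
    [TopologicalSpace E] [AddCommGroup F] [Module ℂ F] [TopologicalSpace F] {H K : Type*}
    [NormedAddCommGroup H] [InnerProductSpace ℂ H] [NormedAddCommGroup K] [InnerProductSpace ℂ K]
    {ι : E →L[ℂ] H} {κ : F →L[ℂ] K} (hι : IsRiggedHilbertSpace ι) (hκ : IsRiggedHilbertSpace κ) :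
    IsRiggedHilbertSpace (tensorIncl ι κ) where
  isTopologicalAddGroup := inferInstance
  continuousSMul := (PolynormableSpace.withSeminorms ℂ (CompletedTensor E F)).continuousSMul
  locallyConvex := inferInstance
  complete := by
    rw [IsUniformAddGroup.rightUniformSpace_eq]
    infer_instance
  nuclear := by
    have := hι.isTopologicalAddGroup
    have := hκ.isTopologicalAddGroup
    have := hι.locallyConvex
    have := hκ.locallyConvex
    exact hι.nuclear.completedTensor hκ.nuclear
  injective := tensorIncl_injective hι hκ
  denseRange := denseRange_tensorIncl hι.denseRange hκ.denseRange

/-! ### Hilbert–Schmidt operators and the Hilbert tensor product -/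

section HilbertSchmidt

variable {H : Type*} [NormedAddCommGroup H] [InnerProductSpace ℂ H]

/-- Polarization: `C` preserves norms and `C (i y) = -i C y`, so the two imaginary terms are
exchanged. -/
theorem inner_map_map_of_antilinear (C : H →ₗᵢ⋆[ℂ] H) (x y : H) : ⟪C x, C y⟫_ℂ = ⟪y, x⟫_ℂ := by
  have h1 : C x - Complex.I • C y = C (x + Complex.I • y) := by
    rw [map_add, C.map_smulₛₗ, Complex.conj_I, neg_smul, sub_eq_add_neg]
  have h2 : C x + Complex.I • C y = C (x - Complex.I • y) := by
    rw [map_sub, C.map_smulₛₗ, Complex.conj_I, neg_smul, sub_neg_eq_add]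
  have h3 : ∀ z : H, ‖C z‖ = ‖z‖ := C.norm_map
  rw [← inner_conj_symm y x, inner_eq_sum_norm_sq_div_four, inner_eq_sum_norm_sq_div_four x y]
  simp only [RCLike.I_to_complex, h1, h2, ← map_add, ← map_sub, h3, map_div₀]
  simp only [map_add, map_sub, map_mul, map_pow, RCLike.conj_ofReal, Complex.conj_I, map_ofNat]
  ring

variable [CompleteSpace H]

theorem rankOne_mem_hsSubmodule (φ ψ : H) : InnerProductSpace.rankOne ℂ φ ψ ∈ hsSubmodule H := by
  change Summable fun i => ‖InnerProductSpace.rankOne ℂ φ ψ (hsBasis H i)‖ ^ 2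
  have h := ((hsBasis H).summable_inner_mul_inner ψ ψ).norm.mul_left (‖φ‖ ^ 2)
  refine h.congr fun i => ?_
  rw [InnerProductSpace.rankOne_apply, norm_smul, norm_mul, norm_inner_symm (hsBasis H i) ψ]
  ring

/-- The rank-one operator `x ↦ ⟨ψ, x⟩ φ` as an element of the Liouville space. -/
def LiouvilleSpace.rankOne (φ ψ : H) : LiouvilleSpace H :=
  ⟨InnerProductSpace.rankOne ℂ φ ψ, rankOne_mem_hsSubmodule φ ψ⟩

@[simp]
theorem LiouvilleSpace.toOp_rankOne (φ ψ x : H) :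
    (LiouvilleSpace.rankOne φ ψ).toOp x = ⟪ψ, x⟫_ℂ • φ :=
  InnerProductSpace.rankOne_apply ..

theorem LiouvilleSpace.ext {A B : LiouvilleSpace H} (h : ∀ x, A.toOp x = B.toOp x) : A = B :=
  LiouvilleSpace.toOp_injective (ContinuousLinearMap.ext h)

/-- Expand `ψ` in the orthonormal basis and apply `⟨φ, B ·⟩` term by term. This identity yields the
norm comparison, the isometry and the surjectivity of `U`. -/
theorem LiouvilleSpace.inner_rankOne_left (φ ψ : H) (B : LiouvilleSpace H) :
    ⟪LiouvilleSpace.rankOne φ ψ, B⟫_ℂ = ⟪φ, B.toOp ψ⟫_ℂ := by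
  have h1 := ((hsBasis H).hasSum_repr ψ).mapL ((innerSL ℂ φ).comp B.toOp)
  refine (LiouvilleSpace.hasSum_inner (hsBasis H) (LiouvilleSpace.rankOne φ ψ) B).unique ?_
  refine h1.congr_fun fun i => ?_
  rw [LiouvilleSpace.toOp_rankOne, inner_smul_left, inner_conj_symm, map_smul,
    HilbertBasis.repr_apply_apply]
  rfl

theorem LiouvilleSpace.norm_rankOne (φ ψ : H) : ‖LiouvilleSpace.rankOne φ ψ‖ = ‖φ‖ * ‖ψ‖ := by
  have h : ((‖LiouvilleSpace.rankOne φ ψ‖ ^ 2 : ℝ) : ℂ) = ((‖φ‖ * ‖ψ‖) ^ 2 : ℝ) := by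
    have h1 := LiouvilleSpace.inner_rankOne_left φ ψ (LiouvilleSpace.rankOne φ ψ)
    rw [LiouvilleSpace.toOp_rankOne, inner_smul_right, inner_self_eq_norm_sq_to_K,
      inner_self_eq_norm_sq_to_K, inner_self_eq_norm_sq_to_K] at h1
    push_cast
    rw [mul_pow, mul_comm]
    exact h1
  exact (sq_eq_sq₀ (norm_nonneg _) (by positivity)).1 (by exact_mod_cast h)

/-- Cauchy–Schwarz against the rank-one operator `⟨x, ·⟩ A x` gives `‖A x‖² ≤ ‖A x‖ ‖x‖ ‖A‖`. -/
theorem LiouvilleSpace.norm_toOp_le (A : LiouvilleSpace H) : ‖A.toOp‖ ≤ ‖A‖ := by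
  refine A.toOp.opNorm_le_bound (norm_nonneg A) fun x => ?_
  have h : ‖A.toOp x‖ * ‖A.toOp x‖ ≤ ‖A.toOp x‖ * (‖A‖ * ‖x‖) := by
    have h1 := norm_inner_le_norm (𝕜 := ℂ) (LiouvilleSpace.rankOne (A.toOp x) x) A
    rw [LiouvilleSpace.inner_rankOne_left, LiouvilleSpace.norm_rankOne,
      inner_self_eq_norm_sq_to_K, norm_pow, RCLike.norm_ofReal, abs_norm] at h1
    linarith
  rcases (norm_nonneg (A.toOp x)).eq_or_lt with h0 | h0
  · rw [← h0]; positivity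
  · exact le_of_mul_le_mul_left h h0

/-- A Cauchy sequence converges in operator norm to some `B`. The Hilbert–Schmidt estimates pass to
the limit on finite partial sums, uniformly in the finite set, which gives both membership of `B`
and convergence. -/
instance : CompleteSpace (LiouvilleSpace H) := by
  refine Metric.complete_of_cauchySeq_tendsto fun A hA => ?_
  let T : LiouvilleSpace H →L[ℂ] (H →L[ℂ] H) :=
    LiouvilleSpace.toOp.mkContinuous 1 fun A => by rw [one_mul]; exact A.norm_toOp_le
  obtain ⟨B, hB⟩ := cauchySeq_tendsto_of_complete (T.uniformContinuous.comp_cauchySeq hA)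
  have hB' : ∀ x, Tendsto (fun n => (A n).toOp x) atTop (𝓝 (B x)) := fun x =>
    ((ContinuousLinearMap.apply ℂ H x).continuous.tendsto B).comp hB
  have key : ∀ ε : ℝ, 0 < ε → ∃ N, ∀ n ≥ N, ∀ s : Finset (hsIndex H),
      ∑ i ∈ s, ‖(B - (A n).toOp) (hsBasis H i)‖ ^ 2 ≤ ε ^ 2 := by
    intro ε hε
    obtain ⟨N, hN⟩ := Metric.cauchySeq_iff.1 hA ε hε
    refine ⟨N, fun n hn s => ?_⟩
    have hlim : Tendsto (fun m => ∑ i ∈ s, ‖(A m - A n).toOp (hsBasis H i)‖ ^ 2) atTop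
        (𝓝 (∑ i ∈ s, ‖(B - (A n).toOp) (hsBasis H i)‖ ^ 2)) := by
      refine tendsto_finsetSum _ fun i _ => ?_
      have h := (((hB' (hsBasis H i)).sub_const ((A n).toOp (hsBasis H i))).norm).pow 2
      simpa only [map_sub, sub_apply] using h
    refine le_of_tendsto hlim (eventually_atTop.2 ⟨N, fun m hm => ?_⟩)
    refine (sum_le_hasSum s (fun i _ => sq_nonneg _)
      (LiouvilleSpace.hasSum_norm_sq (hsBasis H) (A m - A n))).trans ?_
    have h := (hN m hm n hn).le
    rw [dist_eq_norm] at h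
    gcongr
  have hmem : B ∈ hsSubmodule H := by
    obtain ⟨N, hN⟩ := key 1 one_pos
    have h1 : B - (A N).toOp ∈ hsSubmodule H :=
      summable_of_sum_le (fun i => sq_nonneg _) (hN N le_rfl)
    have h2 := add_mem h1 (A N).2
    exact (sub_add_cancel B (A N).toOp) ▸ h2
  let B' : LiouvilleSpace H := ⟨B, hmem⟩
  refine ⟨B', Metric.tendsto_atTop.2 fun ε hε => ?_⟩
  -- `key` yields only a non-strict bound; `ε / 2` makes it strict.
  obtain ⟨N, hN⟩ := key (ε / 2) (half_pos hε)
  refine ⟨N, fun n hn => ?_⟩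
  have h := (LiouvilleSpace.hasSum_norm_sq (hsBasis H) (B' - A n)).tsum_eq ▸
    Real.tsum_le_of_sum_le (fun i => sq_nonneg _) (hN n hn)
  rw [dist_comm, dist_eq_norm]
  have h' := abs_le_of_sq_le_sq' h (half_pos hε).le
  linarith [h'.2]

/-- The bilinear map `(φ, χ) ↦ ⟨C χ, ·⟩ φ`. -/
def conjRankOne (C : H →ₗᵢ⋆[ℂ] H) : H →ₗ[ℂ] H →ₗ[ℂ] LiouvilleSpace H :=
  LinearMap.mk₂ ℂ (fun φ χ => LiouvilleSpace.rankOne φ (C χ))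
    (fun a b χ => LiouvilleSpace.ext fun x => by
      simp only [map_add, add_apply, LiouvilleSpace.toOp_rankOne, smul_add])
    (fun a φ χ => LiouvilleSpace.ext fun x => by
      simp only [map_smul, smul_apply, LiouvilleSpace.toOp_rankOne, smul_comm a])
    (fun φ a b => LiouvilleSpace.ext fun x => by
      simp only [map_add, add_apply, LiouvilleSpace.toOp_rankOne, inner_add_left, add_smul])
    (fun a φ χ => LiouvilleSpace.ext fun x => by
      simp only [C.map_smulₛₗ, map_smul, smul_apply, LiouvilleSpace.toOp_rankOne, inner_smul_left,
        Complex.conj_conj, smul_smul])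

theorem inner_lift_conjRankOne (C : H →ₗᵢ⋆[ℂ] H) (s t : H ⊗[ℂ] H) :
    ⟪TensorProduct.lift (conjRankOne C) s, TensorProduct.lift (conjRankOne C) t⟫_ℂ = ⟪s, t⟫_ℂ := by
  induction s with
  | zero => simp
  | add a b ha hb => rw [map_add, inner_add_left, inner_add_left, ha, hb]
  | tmul φ χ =>
    induction t with
    | zero => simp
    | add a b ha hb => rw [map_add, inner_add_right, inner_add_right, ha, hb]
    | tmul φ' χ' =>
      rw [TensorProduct.lift.tmul, TensorProduct.lift.tmul, TensorProduct.inner_tmul]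
      change ⟪LiouvilleSpace.rankOne φ (C χ), LiouvilleSpace.rankOne φ' (C χ')⟫_ℂ = _
      rw [LiouvilleSpace.inner_rankOne_left, LiouvilleSpace.toOp_rankOne, inner_smul_right,
        inner_map_map_of_antilinear, mul_comm]

/-- A conjugation `C` defines a unitary `H ⊗̄ H → 𝔏(H)` with `φ ⊗ C ψ ↦ ⟨ψ, ·⟩ φ`. -/
theorem exists_liouvilleUnitary (C : H →ₗᵢ⋆[ℂ] H) (hC : ∀ x, C (C x) = x) :
    ∃ U : HilbertTensor H H ≃ₗᵢ[ℂ] LiouvilleSpace H,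
      ∀ φ ψ x : H, (U (HilbertTensor.mk φ (C ψ))).toOp x = ⟪ψ, x⟫_ℂ • φ := by
  let u : H ⊗[ℂ] H →ₗᵢ[ℂ] LiouvilleSpace H :=
    (TensorProduct.lift (conjRankOne C)).isometryOfInner (inner_lift_conjRankOne C)
  let T : HilbertTensor H H →L[ℂ] LiouvilleSpace H := u.toContinuousLinearMap.fromCompletion
  have hT : ∀ t : H ⊗[ℂ] H, T (t : Completion (H ⊗[ℂ] H)) = u t := fun t =>
    ContinuousLinearMap.fromCompletion_apply_coe _ t
  let V : HilbertTensor H H →ₗᵢ[ℂ] LiouvilleSpace H :=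
    ⟨T, fun z => Completion.induction_on z
      (isClosed_eq T.continuous.norm continuous_norm) fun t => by
        change ‖T t‖ = _
        rw [hT, u.norm_map, Completion.norm_coe]⟩
  have hV : ∀ φ ψ, V (HilbertTensor.mk φ (C ψ)) = LiouvilleSpace.rankOne φ ψ := fun φ ψ => by
    have h : V (HilbertTensor.mk φ (C ψ)) = LiouvilleSpace.rankOne φ (C (C ψ)) := hT _
    rw [h, hC]
  have hsurj : Function.Surjective V := by
    -- An isometry from a complete space has complete range, so surjectivity reduces to a trivial
    -- orthogonal complement.
    have : CompleteSpace (LinearMap.range V.toLinearMap) :=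
      V.isometry.isUniformInducing.isComplete_range.completeSpace_coe
    rw [← LinearIsometry.coe_toLinearMap, ← LinearMap.range_eq_top,
      ← Submodule.orthogonal_eq_bot_iff, eq_bot_iff]
    intro A hA
    rw [Submodule.mem_bot]
    refine LiouvilleSpace.ext fun ψ => ?_
    -- Pairing `A` with `⟨ψ, ·⟩ A ψ` gives `‖A ψ‖²`.
    have h := (Submodule.mem_orthogonal _ A).1 hA _ ⟨HilbertTensor.mk (A.toOp ψ) (C ψ), hV _ _⟩
    rw [LiouvilleSpace.inner_rankOne_left, inner_self_eq_zero] at h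
    rw [h]
    simp
  refine ⟨LinearIsometryEquiv.ofSurjective V hsurj, fun φ ψ x => ?_⟩
  rw [LinearIsometryEquiv.coe_ofSurjective, hV, LiouvilleSpace.toOp_rankOne]

/-- Since `y = C (C y)`, the formula prescribes the value on every elementary tensor, and these span
a dense subspace. -/
theorem liouvilleUnitary_unique {C : H →ₗᵢ⋆[ℂ] H} (hC : ∀ x, C (C x) = x)
    {U V : HilbertTensor H H ≃ₗᵢ[ℂ] LiouvilleSpace H}
    (hU : ∀ φ ψ x : H, (U (HilbertTensor.mk φ (C ψ))).toOp x = ⟪ψ, x⟫_ℂ • φ)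
    (hV : ∀ φ ψ x : H, (V (HilbertTensor.mk φ (C ψ))).toOp x = ⟪ψ, x⟫_ℂ • φ) : V = U := by
  let s : Submodule ℂ (HilbertTensor H H) :=
    LinearMap.eqLocus (V.toLinearEquiv : HilbertTensor H H →ₗ[ℂ] LiouvilleSpace H)
      (U.toLinearEquiv : HilbertTensor H H →ₗ[ℂ] LiouvilleSpace H)
  have hmk : ∀ x y, V (HilbertTensor.mk x y) = U (HilbertTensor.mk x y) := fun x y =>
    LiouvilleSpace.ext fun z => by
      rw [← hC y]
      exact (hV _ _ _).trans (hU _ _ _).symm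
  have hs : s = ⊤ := HilbertTensor.eq_top_of_isClosed (isClosed_eq V.continuous U.continuous) hmk
  ext1 z
  exact (hs ▸ Submodule.mem_top : z ∈ s)

end HilbertSchmidt

/-! ### Isomorphisms of rigged Hilbert spaces -/

section Transfer

/-- `f` may be antilinear and so need not itself give a linear isomorphism onto its image. The map
`c` repairs this: the image is also `ι(E)`, the corestriction of `ι` is the quotient map `r` after
`c`, and its inverse composed with `r` is `c`, so both directions are continuous. -/
theorem ImageSpace.exists_equiv {σ : ℂ →+* ℂ} [RingHomSurjective σ] {E G : Type*} [AddCommGroup E]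
    [Module ℂ E] [TopologicalSpace E] [AddCommGroup G] [Module ℂ G] [TopologicalSpace G]
    (f : E →SL[σ] G) (ι : E →L[ℂ] G) (hι : Function.Injective ι) (c : E → E) (hc : Continuous c)
    (hfc : ∀ x, f (c x) = ι x) (hιc : ∀ x, ι (c x) = f x) :
    ∃ e : E ≃L[ℂ] ImageSpace f, ∀ x, ImageSpace.incl f (e x) = ι x := by
  let r : E → ImageSpace f := fun x => ⟨f x, ⟨x, rfl⟩⟩
  have hr : Continuous r := continuous_coinduced_rng
  let T : E →ₗ[ℂ] ImageSpace f :=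
    LinearMap.codRestrict (LinearMap.range (f : E →ₛₗ[σ] G)) (ι : E →ₗ[ℂ] G)
      fun x => ⟨c x, hfc x⟩
  have hT : ∀ x, T (c x) = r x := fun x => Subtype.ext (hιc x)
  have hT' : ∀ x, T x = r (c x) := fun x => Subtype.ext (hfc x).symm
  have hinj : Function.Injective T := fun x y h => hι (congrArg Subtype.val h)
  have hsurj : Function.Surjective T := by
    rintro ⟨_, x, rfl⟩
    exact ⟨c x, hT x⟩
  let e := LinearEquiv.ofBijective T ⟨hinj, hsurj⟩
  refine ⟨⟨e, (hr.comp hc).congr fun x => (hT' x).symm, continuous_coinduced_dom.2 ?_⟩,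
    fun x => rfl⟩
  exact hc.congr fun x => ((LinearEquiv.symm_apply_eq e).2 (hT x).symm).symm

theorem IsNuclear.congr {E F : Type u} [AddCommGroup E] [Module ℂ E] [TopologicalSpace E]
    [AddCommGroup F] [Module ℂ F] [TopologicalSpace F] (hE : IsNuclear E) (e : E ≃L[ℂ] F) :
    IsNuclear F := by
  intro B _ _ _ u
  obtain ⟨c, f, y, hc, ⟨p, hp, hf⟩, hy, hsum⟩ := hE B (u.comp (e : E →L[ℂ] F))
  refine ⟨c, fun n => (f n).comp (e.symm : F →L[ℂ] E), y, hc,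
    ⟨p.comp (e.symm : F →ₗ[ℂ] E), hp.comp e.symm.continuous, fun n x => hf n _⟩, hy, fun x => ?_⟩
  simpa using hsum (e.symm x)

theorem IsRiggedHilbertSpace.congr {E F : Type u} [AddCommGroup E] [Module ℂ E]
    [TopologicalSpace E] [AddCommGroup F] [Module ℂ F] [TopologicalSpace F] {H K : Type*}
    [NormedAddCommGroup H] [InnerProductSpace ℂ H] [NormedAddCommGroup K] [InnerProductSpace ℂ K]
    {ι : E →L[ℂ] H} {κ : F →L[ℂ] K} (hι : IsRiggedHilbertSpace ι) (e : E ≃L[ℂ] F)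
    (V : H ≃ₗᵢ[ℂ] K) (h : ∀ x, κ (e x) = V (ι x)) : IsRiggedHilbertSpace κ := by
  have := hι.isTopologicalAddGroup
  have := hι.locallyConvex
  have hF : PolynormableSpace ℂ F :=
    IsInducing.polynormableSpace (f := (e.symm : F →ₗ[ℂ] E)) e.symm.toHomeomorph.isInducing
  have hg : IsTopologicalAddGroup F := (PolynormableSpace.withSeminorms ℂ F).topologicalAddGroup
  have hκ : ⇑κ = V ∘ ι ∘ e.symm := funext fun y => by
    rw [Function.comp_apply, Function.comp_apply, ← h, e.apply_symm_apply]
  exact {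
    isTopologicalAddGroup := hg
    continuousSMul := (PolynormableSpace.withSeminorms ℂ F).continuousSMul
    locallyConvex := hF
    complete := by
      let := IsTopologicalAddGroup.rightUniformSpace E
      let := IsTopologicalAddGroup.rightUniformSpace F
      have : IsUniformAddGroup E := isUniformAddGroup_of_addCommGroup
      have : IsUniformAddGroup F := isUniformAddGroup_of_addCommGroup
      have hE : CompleteSpace E := hι.complete
      exact (completeSpace_congr (e := e.toEquiv) e.isUniformEmbedding).1 hE
    nuclear := hι.nuclear.congr e
    injective := by
      rw [hκ]
      exact V.injective.comp (hι.injective.comp e.symm.injective)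
    denseRange := by
      rw [hκ]
      exact V.surjective.denseRange.comp
        (hι.denseRange.comp e.symm.surjective.denseRange ι.continuous) V.continuous }

/-! ### Replacing the second factor of a completed tensor product. -/

section CongrRight

variable {E F F' : Type*} [AddCommGroup E] [Module ℂ E] [TopologicalSpace E]
  [IsTopologicalAddGroup E] [AddCommGroup F] [Module ℂ F] [TopologicalSpace F]
  [AddCommGroup F'] [Module ℂ F'] [TopologicalSpace F'] [IsTopologicalAddGroup F']

theorem CompletedTensor.exists_map_right (g : F →L[ℂ] F') :
    ∃ T : CompletedTensor E F →L[ℂ] CompletedTensor E F',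
      ∀ x y, T (CompletedTensor.mk x y) = CompletedTensor.mk x (g y) := by
  let b : E →ₗ[ℂ] F →ₗ[ℂ] ProjTensor E F' := ProjTensor.mkₗ.compl₂ (g : F →ₗ[ℂ] F')
  have hb : Continuous fun z : E × F => b z.1 z.2 :=
    ProjTensor.continuous_mk.comp (f := fun z : E × F => (z.1, g z.2)) (by fun_prop)
  refine ⟨(ProjTensor.lift b hb).completion, fun x y => ?_⟩
  rw [CompletedTensor.mk, ContinuousLinearMap.completion_apply_coe, ProjTensor.lift_mk]
  rfl

/-- An isomorphism of the second factors induces one of the completed tensor products. -/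
theorem CompletedTensor.exists_congr_right [IsTopologicalAddGroup F] (e : F ≃L[ℂ] F') :
    ∃ T : CompletedTensor E F ≃L[ℂ] CompletedTensor E F',
      ∀ x y, T (CompletedTensor.mk x y) = CompletedTensor.mk x (e y) := by
  obtain ⟨S, hS⟩ := CompletedTensor.exists_map_right (E := E) (e : F →L[ℂ] F')
  obtain ⟨T, hT⟩ := CompletedTensor.exists_map_right (E := E) (e.symm : F' →L[ℂ] F)
  refine ⟨ContinuousLinearEquiv.equivOfInverse S T ?_ ?_, hS⟩
  · exact CompletedTensor.ext (S := T.comp S) (T := .id ℂ _) fun x y => by simp [hS, hT]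
  · exact CompletedTensor.ext (S := S.comp T) (T := .id ℂ _) fun x y => by simp [hS, hT]

end CongrRight

end Transfer

/-! ### Weak-* continuity and weak-* density of bras and kets -/

section WeakStar

variable {σ : ℂ →+* ℂ} {E F : Type*} [AddCommGroup E] [Module ℂ E] [TopologicalSpace E]
  [AddCommGroup F] [Module ℂ F] [TopologicalSpace F]

theorem WeakStarContinuous.of_apply_eq {G : (E →SL[σ] ℂ) → (F →SL[σ] ℂ)} (τ : F → E)
    (h : ∀ f y, G f y = f (τ y)) : WeakStarContinuous G := by
  let t : TopologicalSpace (E →SL[σ] ℂ) :=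
    TopologicalSpace.induced (fun (f : E →SL[σ] ℂ) (x : E) => f x) inferInstance
  have hτ : Continuous fun (f : E →SL[σ] ℂ) (y : F) => f (τ y) :=
    continuous_pi fun y => (continuous_apply (τ y)).comp continuous_induced_dom
  exact continuous_induced_rng.2 (hτ.congr fun f => funext fun y => (h f y).symm)

/-- `hD` is weak-* density of `D`, since a basic neighbourhood constrains only finitely many values.
The equalizer of the two maps, tested at one point `y`, is closed; linearity plays no role. -/
theorem WeakStarContinuous.eq_of_eqOn {G G' : (E →SL[σ] ℂ) → (F →SL[σ] ℂ)}
    (hG : WeakStarContinuous G) (hG' : WeakStarContinuous G') {D : Set (E →SL[σ] ℂ)}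
    (hD : ∀ (f : E →SL[σ] ℂ) (s : Finset E), ∃ d ∈ D, ∀ x ∈ s, d x = f x)
    (h : ∀ d ∈ D, G d = G' d) (f : E →SL[σ] ℂ) : G f = G' f := by
  let t : TopologicalSpace (E →SL[σ] ℂ) :=
    TopologicalSpace.induced (fun (f : E →SL[σ] ℂ) (x : E) => f x) inferInstance
  ext y
  have hc : ∀ G : (E →SL[σ] ℂ) → (F →SL[σ] ℂ), WeakStarContinuous G →
      Continuous[t, _] fun f => G f y := fun G hG =>
    (continuous_apply y).comp (continuous_induced_rng.1 hG)
  have hf : f ∈ closure[t] D := by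
    rw [@mem_closure_iff _ t]
    rintro _ ⟨U, hU, rfl⟩ hfU
    obtain ⟨s, u, hu, hsu⟩ := isOpen_pi_iff.1 hU _ hfU
    obtain ⟨d, hdD, hd⟩ := hD f s
    refine ⟨d, hsu fun x hx => ?_, hdD⟩
    have hfx : f x ∈ u x := (hu x hx).2
    rwa [← hd x hx] at hfx
  have hsub : closure[t] D ⊆ {f | G f y = G' f y} :=
    closure_minimal (fun d hd => DFunLike.congr_fun (h d hd) y)
      (isClosed_eq (hc G hG) (hc G' hG'))
  exact hsub hf

variable {H : Type*} [NormedAddCommGroup H] [InnerProductSpace ℂ H]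

/-- On finitely many vectors, a linear functional is given by an inner product. -/
theorem exists_inner_eq_on_finset {ι : E →ₗ[ℂ] H} (hι : Function.Injective ι) (L : E →ₗ[ℂ] ℂ)
    (s : Finset E) : ∃ X, ∀ x ∈ s, ⟪ι X, ι x⟫_ℂ = L x := by
  let W : Submodule ℂ E := Submodule.span ℂ s
  let e : W ≃ₗ[ℂ] W.map ι := W.equivMapOfInjective ι hι
  have : FiniteDimensional ℂ W := FiniteDimensional.span_finset ℂ s
  have : FiniteDimensional ℂ (W.map ι) := Module.Finite.equiv e
  have : CompleteSpace (W.map ι) := FiniteDimensional.complete ℂ _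
  let l : W.map ι →ₗ[ℂ] ℂ := (L.comp W.subtype).comp (e.symm : W.map ι →ₗ[ℂ] W)
  -- Riesz representation on the finite-dimensional image of the span of `s`, where the transported
  -- functional is automatically continuous.
  let v : W.map ι := (InnerProductSpace.toDual ℂ (W.map ι)).symm (LinearMap.toContinuousLinearMap l)
  obtain ⟨X, -, hX⟩ := v.2
  refine ⟨X, fun x hx => ?_⟩
  let x' : W := ⟨x, Submodule.subset_span hx⟩
  have h : ⟪v, e x'⟫_ℂ = l (e x') := InnerProductSpace.toDual_symm_apply
  have hl : l (e x') = L x := by simp [l, x']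
  rw [hX, ← hl, ← h]
  rfl

theorem exists_braFunctional_eq_on_finset {ι : E →L[ℂ] H} (hι : Function.Injective ι)
    (f : E →L[ℂ] ℂ) (s : Finset E) :
    ∃ d ∈ Set.range fun X => braFunctional ι (ι X), ∀ x ∈ s, d x = f x := by
  obtain ⟨X, hX⟩ := exists_inner_eq_on_finset (ι := (ι : E →ₗ[ℂ] H)) hι (f : E →ₗ[ℂ] ℂ) s
  exact ⟨_, ⟨X, rfl⟩, hX⟩

theorem exists_ketFunctional_eq_on_finset {ι : E →L[ℂ] H} (hι : Function.Injective ι)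
    (f : E →L⋆[ℂ] ℂ) (s : Finset E) :
    ∃ d ∈ Set.range fun X => ketFunctional ι (ι X), ∀ x ∈ s, d x = f x := by
  -- Conjugation makes the antilinear functional linear, so the finite-dimensional Riesz argument
  -- applies.
  let L : E →ₗ[ℂ] ℂ :=
    { toFun := fun x => starRingEnd ℂ (f x)
      map_add' := fun x y => by simp
      map_smul' := fun a x => by simp }
  obtain ⟨X, hX⟩ := exists_inner_eq_on_finset (ι := (ι : E →ₗ[ℂ] H)) hι L s
  refine ⟨_, ⟨X, rfl⟩, fun x hx => ?_⟩
  have h : ⟪ι x, ι X⟫_ℂ = f x := by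
    rw [← inner_conj_symm]
    exact (congrArg (starRingEnd ℂ) (hX x hx)).trans (Complex.conj_conj _)
  exact h

end WeakStar
/-! ### Dual extensions of an isomorphism of test spaces -/

section DualExtension

variable {E F H K : Type*} [AddCommGroup E] [Module ℂ E] [TopologicalSpace E] [AddCommGroup F]
  [Module ℂ F] [TopologicalSpace F] [NormedAddCommGroup H] [InnerProductSpace ℂ H]
  [NormedAddCommGroup K] [InnerProductSpace ℂ K] {ι : E →L[ℂ] H} {κ : F →L[ℂ] K}

theorem exists_dual_extension (hι : Function.Injective ι) (V : K ≃ₗᵢ[ℂ] H) (Λ : E ≃L[ℂ] F)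
    (hΛ : ∀ X, κ (Λ X) = V.symm (ι X)) :
    ∃ Λd : (E →L[ℂ] ℂ) ≃L[ℂ] (F →L[ℂ] ℂ),
      (∀ f Y, Λd f Y = f (Λ.symm Y)) ∧
      (∀ A, Λd (braFunctional ι A) = braFunctional κ (V.symm A)) ∧
      WeakStarContinuous (σ := RingHom.id ℂ) Λd ∧
      WeakStarContinuous (σ := RingHom.id ℂ) Λd.symm ∧
      ∀ G : (E →L[ℂ] ℂ) → (F →L[ℂ] ℂ), WeakStarContinuous G →
        (∀ X, G (braFunctional ι (ι X)) = braFunctional κ (κ (Λ X))) → ∀ f, G f = Λd f := by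
  -- The spaces of functionals carry uniform convergence on bounded sets, so this equivalence is a
  -- homeomorphism for the strong topologies.
  let Λd : (E →L[ℂ] ℂ) ≃L[ℂ] (F →L[ℂ] ℂ) := Λ.arrowCongrSL (.refl ℂ ℂ)
  have happ : ∀ f Y, Λd f Y = f (Λ.symm Y) := fun f Y => rfl
  have hbra : ∀ A, Λd (braFunctional ι A) = braFunctional κ (V.symm A) := fun A => by
    ext Y
    obtain ⟨X, rfl⟩ := Λ.surjective Y
    rw [happ, Λ.symm_apply_apply]
    change ⟪A, ι X⟫_ℂ = ⟪V.symm A, κ (Λ X)⟫_ℂ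
    rw [hΛ, V.symm.inner_map_map]
  have hcont : WeakStarContinuous (σ := RingHom.id ℂ) Λd := .of_apply_eq Λ.symm happ
  refine ⟨Λd, happ, hbra, hcont, .of_apply_eq Λ fun f Y => rfl, fun G hG hGX => ?_⟩
  refine hG.eq_of_eqOn hcont (exists_braFunctional_eq_on_finset hι) ?_
  rintro _ ⟨X, rfl⟩
  rw [hGX, hbra, hΛ]

theorem exists_antidual_extension (hι : Function.Injective ι) (V : K ≃ₗᵢ[ℂ] H) (Λ : E ≃L[ℂ] F)
    (hΛ : ∀ X, κ (Λ X) = V.symm (ι X)) :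
    ∃ Λx : (E →L⋆[ℂ] ℂ) ≃L[ℂ] (F →L⋆[ℂ] ℂ),
      (∀ f Y, Λx f Y = f (Λ.symm Y)) ∧
      (∀ A, Λx (ketFunctional ι A) = ketFunctional κ (V.symm A)) ∧
      WeakStarContinuous (σ := starRingEnd ℂ) Λx ∧
      WeakStarContinuous (σ := starRingEnd ℂ) Λx.symm ∧
      ∀ G : (E →L⋆[ℂ] ℂ) → (F →L⋆[ℂ] ℂ), WeakStarContinuous G →
        (∀ X, G (ketFunctional ι (ι X)) = ketFunctional κ (κ (Λ X))) → ∀ f, G f = Λx f := by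
  let Λx : (E →L⋆[ℂ] ℂ) ≃L[ℂ] (F →L⋆[ℂ] ℂ) := Λ.arrowCongrSL (.refl ℂ ℂ)
  have happ : ∀ f Y, Λx f Y = f (Λ.symm Y) := fun f Y => rfl
  have hket : ∀ A, Λx (ketFunctional ι A) = ketFunctional κ (V.symm A) := fun A => by
    ext Y
    obtain ⟨X, rfl⟩ := Λ.surjective Y
    rw [happ, Λ.symm_apply_apply]
    change ⟪ι X, A⟫_ℂ = ⟪κ (Λ X), V.symm A⟫_ℂ
    rw [hΛ, V.symm.inner_map_map]
  have hcont : WeakStarContinuous (σ := starRingEnd ℂ) Λx := .of_apply_eq Λ.symm happ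
  refine ⟨Λx, happ, hket, hcont, .of_apply_eq Λ fun f Y => rfl, fun G hG hGX => ?_⟩
  refine hG.eq_of_eqOn hcont (exists_ketFunctional_eq_on_finset hι) ?_
  rintro _ ⟨X, rfl⟩
  rw [hGX, hket, hΛ]

end DualExtension

end

/-! ### The rigged Liouville space and the TFD triplet. -/

theorem mainTheorem1 {H : Type u} [NormedAddCommGroup H] [InnerProductSpace ℂ H]
    [CompleteSpace H] {Φ : Type u} [AddCommGroup Φ] [Module ℂ Φ] [TopologicalSpace Φ]
    (ι : Φ →L[ℂ] H) (hΦ : IsRiggedHilbertSpace ι)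
    (C : H →ₗᵢ⋆[ℂ] H) (hC : ∀ x, C (C x) = x)
    (hCΦ : ∃ c : Φ → Φ, Continuous c ∧ ∀ φ, ι (c φ) = C (ι φ)) :
    ∃ U : HilbertTensor H H ≃ₗᵢ[ℂ] LiouvilleSpace H,
      -- `U` is the unique unitary with `U (φ ⊗ C ψ) = ⟨ψ, ·⟩ φ`
      (∀ φ ψ x : H, (U (HilbertTensor.mk φ (C ψ))).toOp x = ⟪ψ, x⟫_ℂ • φ) ∧
      (∀ V : HilbertTensor H H ≃ₗᵢ[ℂ] LiouvilleSpace H,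
        (∀ φ ψ x : H, (V (HilbertTensor.mk φ (C ψ))).toOp x = ⟪ψ, x⟫_ℂ • φ) → V = U) ∧
      -- the rigged Liouville space and the TFD triplet are rigged Hilbert spaces
      IsRiggedHilbertSpace (liouvilleIncl U ι) ∧
      IsRiggedHilbertSpace (tfdIncl C ι) ∧
      -- the topological isomorphism `Λ`, which is the restriction of `U⁻¹`
      ∃ Λ : RiggedLiouville U ι ≃L[ℂ] TFDSpace C ι,
        (∀ X, tfdIncl C ι (Λ X) = U.symm (liouvilleIncl U ι X)) ∧
        -- its continuous extension to the dual spaces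
        (∃ Λd : (RiggedLiouville U ι →L[ℂ] ℂ) ≃L[ℂ] (TFDSpace C ι →L[ℂ] ℂ),
          (∀ F Y, Λd F Y = F (Λ.symm Y)) ∧
          (∀ A, Λd (braFunctional (liouvilleIncl U ι) A)
            = braFunctional (tfdIncl C ι) (U.symm A)) ∧
          WeakStarContinuous (σ := RingHom.id ℂ) Λd ∧
          WeakStarContinuous (σ := RingHom.id ℂ) Λd.symm ∧
          ∀ G : (RiggedLiouville U ι →L[ℂ] ℂ) → (TFDSpace C ι →L[ℂ] ℂ), WeakStarContinuous G →
            (∀ X, G (braFunctional (liouvilleIncl U ι) (liouvilleIncl U ι X))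
              = braFunctional (tfdIncl C ι) (tfdIncl C ι (Λ X))) →
            ∀ F, G F = Λd F) ∧
        -- its continuous extension to the anti-dual spaces
        (∃ Λx : (RiggedLiouville U ι →L⋆[ℂ] ℂ) ≃L[ℂ] (TFDSpace C ι →L⋆[ℂ] ℂ),
          (∀ F Y, Λx F Y = F (Λ.symm Y)) ∧
          (∀ A, Λx (ketFunctional (liouvilleIncl U ι) A)
            = ketFunctional (tfdIncl C ι) (U.symm A)) ∧
          WeakStarContinuous (σ := starRingEnd ℂ) Λx ∧
          WeakStarContinuous (σ := starRingEnd ℂ) Λx.symm ∧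
          ∀ G : (RiggedLiouville U ι →L⋆[ℂ] ℂ) → (TFDSpace C ι →L⋆[ℂ] ℂ), WeakStarContinuous G →
            (∀ X, G (ketFunctional (liouvilleIncl U ι) (liouvilleIncl U ι X))
              = ketFunctional (tfdIncl C ι) (tfdIncl C ι (Λ X))) →
            ∀ F, G F = Λx F) := by
  obtain ⟨U, hU⟩ := exists_liouvilleUnitary C hC
  obtain ⟨c, hc, hcC⟩ := hCΦ
  have := hΦ.isTopologicalAddGroup
  have hTensor : IsRiggedHilbertSpace (tensorIncl ι ι) := hΦ.tensorIncl hΦ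
  -- This map is already linear, so the auxiliary map is the identity.
  obtain ⟨eL, heL⟩ := ImageSpace.exists_equiv
    ((U.toContinuousLinearEquiv : HilbertTensor H H →L[ℂ] LiouvilleSpace H).comp (tensorIncl ι ι))
    _ (U.injective.comp hTensor.injective) id continuous_id (fun _ => rfl) fun _ => rfl
  -- Here `c` is the conjugation restricted to `Φ`; `eT` is the linear identification of `Φ` with
  -- `C(Φ)` that fixes each vector of `H`.
  obtain ⟨eT, heT⟩ := ImageSpace.exists_equiv (C.toContinuousLinearMap.comp ι) ι hΦ.injective c hc
    (fun x => (congrArg C (hcC x)).trans (hC _)) hcC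
  have hL : IsRiggedHilbertSpace (liouvilleIncl U ι) := hTensor.congr eL U heL
  have hTilde : IsRiggedHilbertSpace (tildeIncl C ι) := hΦ.congr eT (.refl ℂ H) heT
  have := hTilde.isTopologicalAddGroup
  obtain ⟨e, he⟩ := CompletedTensor.exists_congr_right (E := Φ) eT
  -- `e` is `1 ⊗ eT`, and `eT` does not move vectors of `H`, so the canonical maps agree on
  -- elementary tensors.
  have heι : ∀ z, tfdIncl C ι (e z) = tensorIncl ι ι z :=
    CompletedTensor.ext
      (S := (tfdIncl C ι).comp (e : CompletedTensor Φ Φ →L[ℂ] TFDSpace C ι)) fun x y => by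
      change tfdIncl C ι (e (CompletedTensor.mk x y)) = _
      rw [he, tensorIncl_mk, tensorIncl_mk, heT]
  let Λ : RiggedLiouville U ι ≃L[ℂ] TFDSpace C ι := eL.symm.trans e
  have hΛ : ∀ X, tfdIncl C ι (Λ X) = U.symm (liouvilleIncl U ι X) := fun X => by
    obtain ⟨z, rfl⟩ := eL.surjective X
    change tfdIncl C ι (e (eL.symm (eL z))) = U.symm (liouvilleIncl U ι (eL z))
    rw [eL.symm_apply_apply, heι, heL]
    exact (U.symm_apply_apply _).symm
  exact ⟨U, hU, fun V hV => liouvilleUnitary_unique hC hU hV, hL, hΦ.tensorIncl hTilde, Λ, hΛ,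
    exists_dual_extension hL.injective U Λ hΛ, exists_antidual_extension hL.injective U Λ hΛ⟩
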